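/- There are absolute constants $c,C>0$ with the following property. Let $n\ge1$ and let $Z(t_1),\dots,Z(t_n)$ be jointly multivariate normal random variables with $\mathbb{E}Z(t_i)=0$ and $\mathbb{E}Z(t_i)^2=1$ for all $i$. Suppose that the sequence is stationary, i.e. $\mathbb{E}Z(t_j)Z(t_k)=r(|j-k|)$ for all $1\le j,k\le n$ and some function $r$ which is non-increasing and non-negative. Let $u\ge1$ and suppose that $r(1)(1+2u^{-2})\le1$. Then there are real numbers $E_1,\dots,E_{n-1}$ with $$|E_j|\le\frac{C}{u^2(1-r(j))}\qquad(1\le j\le n-1)$$ such that $$\mathbb{P}\Big(\max_{1\le i\le n}Z(t_i)>u\Big)\ \ge\ c\,n\,\frac{e^{-u^2/2}}{u}\,\min\Big\{1,\sqrt{\frac{1-r(1)}{u^2r(1)}}\Big\}\prod_{j=1}^{n-1}\Phi\Big(u\sqrt{1-r(j)}\,(1+E_j)\Big),$$ where $\Phi$ is the standard normal cumulative distribution function, and where the minimum is read as $1$ if $r(1)=0$. -/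

import Mathlib

open MeasureTheory ProbabilityTheory

/-- The standard normal cumulative distribution function `Φ`. -/
noncomputable def stdNormalCDF (x : ℝ) : ℝ := cdf (gaussianReal 0 1) x

/-- The factor `min {1, √((1 - ρ) / (u² ρ))}` for a correlation `0 ≤ ρ < 1`, where the quotient
is read as `+∞`, so that the factor is `1`, when `ρ = 0`. -/
noncomputable def correlationFactor (u ρ : ℝ) : ℝ :=
  if ρ = 0 then 1 else min 1 (√((1 - ρ) / (u ^ 2 * ρ)))

/-- `Z 0, …, Z (n - 1)` are jointly multivariate normal, centred, of variance one, and
stationary: the correlation of `Z i` and `Z j` is `r |i - j|`. -/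
structure IsStationaryGaussianSequence {Ω : Type*} [MeasurableSpace Ω] (P : Measure Ω)
    {n : ℕ} (Z : Fin n → Ω → ℝ) (r : ℕ → ℝ) : Prop where
  jointly_gaussian : HasGaussianLaw (fun ω i => Z i ω) P
  mean_zero : ∀ i, ∫ ω, Z i ω ∂P = 0
  variance_one : ∀ i, ∫ ω, Z i ω ^ 2 ∂P = 1
  correlation : ∀ i j, ∫ ω, Z i ω * Z j ω ∂P = r ((i : ℤ) - (j : ℤ)).natAbs

/-! Split according to the first index `m` at which the level is exceeded, keeping only paths with
`Z m` in `(u, u + 1/u]` and `Z j ≤ u` for `j < m`. These events are disjoint and lie in the event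
that the maximum exceeds `u`, so it suffices to bound each of them below by the same quantity and
multiply by `n`.

For fixed `m` put `ρ j = r (m - j)`. The residuals `Z j - ρ j * Z m` are independent of `Z m`, and
the event holds as soon as `Z m` lies in the interval and every residual is at most `u (1 - ρ j) -
1/u`. The first condition costs a constant times `exp (-u²/2) / u`. Since `r` is non-increasing, the
residuals have covariance `r (j - i) - ρ i ρ j ≥ ρ i (1 - ρ j)` for `i < j`, which is the covariance
of a Brownian bridge at the times `ρ i`, and their variance is `ρ i (1 - ρ i) + (1 - ρ i)`.
Slepian's inequality therefore allows them to be replaced by a bridge plus independent noise of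
variance `1 - ρ i`.

The bridge is `(1 - t) W (t / (1 - t))`. Lévy's inequality keeps `W` below `1/u` with probability at
least a constant times the correlation factor, and the independent noise yields the product of
values of `Φ`. Slepian's inequality itself is proved by Lindeberg replacement: small independent
Gaussian pieces are exchanged one at a time, and only their covariances matter to second order. -/

/-! ### Smooth test functions with bounded derivatives. -/

section BoundedDerivatives

variable {E E' : Type*} [NormedAddCommGroup E] [NormedSpace ℝ E]
  [NormedAddCommGroup E'] [NormedSpace ℝ E']

/-- `F` is three times continuously differentiable, and `F` and its derivatives up to order three
are bounded. -/
def BddContDiff (F : E → ℝ) : Prop :=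
  ContDiff ℝ 3 F ∧ ∃ K : ℝ, ∀ i ≤ 3, ∀ x, ‖iteratedFDeriv ℝ i F x‖ ≤ K

theorem BddContDiff.const (c : ℝ) : BddContDiff (fun _ : E => c) := by
  refine ⟨contDiff_const, ‖c‖, fun i _ x => ?_⟩
  rcases Nat.eq_zero_or_pos i with rfl | hi
  · simp
  · rw [iteratedFDeriv_const_of_ne hi.ne']
    simp

theorem BddContDiff.mul {F G : E → ℝ} (hF : BddContDiff F) (hG : BddContDiff G) :
    BddContDiff (fun x => F x * G x) := by
  obtain ⟨cF, K, hK⟩ := hF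
  obtain ⟨cG, M, hM⟩ := hG
  refine ⟨cF.mul cG, 8 * (K * M), fun i hi x => ?_⟩
  have hK0 : 0 ≤ K := (norm_nonneg _).trans (hK 0 (by norm_num) x)
  have hM0 : 0 ≤ M := (norm_nonneg _).trans (hM 0 (by norm_num) x)
  refine (norm_iteratedFDeriv_mul_le cF cG x (n := i) (by exact_mod_cast hi)).trans ?_
  calc ∑ k ∈ Finset.range (i + 1),
          (i.choose k : ℝ) * ‖iteratedFDeriv ℝ k F x‖ * ‖iteratedFDeriv ℝ (i - k) G x‖
      ≤ ∑ k ∈ Finset.range (i + 1), (i.choose k : ℝ) * K * M := by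
        gcongr with k hk
        · exact hK k (by simp at hk; omega) x
        · exact hM (i - k) (by omega) x
    _ = 2 ^ i * (K * M) := by
        have := Nat.sum_range_choose i
        simp_rw [mul_assoc]
        rw [← Finset.sum_mul]
        exact_mod_cast congrArg (fun z : ℕ => (z : ℝ) * (K * M)) this
    _ ≤ 8 * (K * M) := by
        gcongr
        calc (2 : ℝ) ^ i ≤ 2 ^ 3 := by gcongr; norm_num
          _ = 8 := by norm_num

theorem BddContDiff.prod {ι : Type*} {F : ι → E → ℝ} (s : Finset ι)
    (hF : ∀ i, BddContDiff (F i)) : BddContDiff (fun x => ∏ i ∈ s, F i x) := by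
  classical
  induction s using Finset.induction_on with
  | empty => simpa using BddContDiff.const 1
  | insert a s ha ih => simpa [Finset.prod_insert ha] using (hF a).mul ih

theorem BddContDiff.comp_clm {F : E → ℝ} (hF : BddContDiff F) (A : E' →L[ℝ] E) :
    BddContDiff (fun x => F (A x)) := by
  obtain ⟨cF, K, hK⟩ := hF
  refine ⟨cF.comp A.contDiff, max 1 ‖A‖ ^ 3 * K, fun i hi x => ?_⟩
  have hK0 : 0 ≤ K := (norm_nonneg _).trans (hK 0 (by norm_num) (A x))
  have := ContinuousLinearMap.iteratedFDeriv_comp_right A cF x (i := i) (by exact_mod_cast hi)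
  change ‖iteratedFDeriv ℝ i (F ∘ A) x‖ ≤ _
  rw [this]
  refine (ContinuousMultilinearMap.norm_compContinuousLinearMap_le _ _).trans ?_
  simp only [Finset.prod_const, Finset.card_univ, Fintype.card_fin]
  rw [mul_comm]
  gcongr
  · calc ‖A‖ ^ i ≤ max 1 ‖A‖ ^ i := by gcongr; exact le_max_right _ _
      _ ≤ max 1 ‖A‖ ^ 3 := by gcongr; exact le_max_left _ _
  · exact hK i hi _

theorem BddContDiff.integrable {F : E → ℝ} (hF : BddContDiff F) [MeasurableSpace E]
    [OpensMeasurableSpace E] (μ : Measure E) [IsFiniteMeasure μ] : Integrable F μ := by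
  obtain ⟨cF, K, hK⟩ := hF
  refine Integrable.of_bound cF.continuous.measurable.aestronglyMeasurable K (ae_of_all _ fun x => ?_)
  simpa using hK 0 (by norm_num) x

/-- The remainder is an integral of the bounded third derivative, so the constant does not depend on
the base point. This uniformity is what permits iterated replacement. -/
theorem BddContDiff.exists_taylor {F : E → ℝ} (hF : BddContDiff F) :
    ∃ K, 0 ≤ K ∧ ∀ m h, |F (m + h) - (F m + fderiv ℝ F m h + 2⁻¹ * fderiv ℝ (fderiv ℝ F) m h h)|
      ≤ K * ‖h‖ ^ 3 := by
  obtain ⟨cF, K, hK⟩ := hF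
  have hK0 : 0 ≤ K := (norm_nonneg _).trans (hK 0 (by norm_num) 0)
  refine ⟨K, hK0, fun m h => ?_⟩
  have key := map_add_eq_sum_add_integral_iteratedFDeriv (f := F) (n := 2) (x := m) (y := h)
    (fun t _ => by simpa using! cF.contDiffAt)
  have e1 : iteratedFDeriv ℝ 1 F m (fun _ => h) = fderiv ℝ F m h := by
    rw [iteratedFDeriv_one_apply]
  have e2 : iteratedFDeriv ℝ 2 F m (fun _ => h) = fderiv ℝ (fderiv ℝ F) m h h := by
    rw [iteratedFDeriv_two_apply]
  simp only [Finset.sum_range_succ, Finset.sum_range_zero, e1, e2, iteratedFDeriv_zero_apply] at key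
  have hI : ‖∫ t in (0:ℝ)..1, (1 - t) ^ 2 • iteratedFDeriv ℝ (2 + 1) F (m + t • h) (fun _ => h)‖
      ≤ K * ‖h‖ ^ 3 * |1 - 0| := by
    refine intervalIntegral.norm_integral_le_of_norm_le_const fun t ht => ?_
    rw [Set.uIoc_of_le zero_le_one] at ht
    rw [norm_smul]
    have h1 : ‖(1 - t) ^ 2‖ ≤ 1 := by
      rw [Real.norm_eq_abs, abs_of_nonneg (sq_nonneg _)]
      nlinarith [ht.1, ht.2]
    have h2 : ‖iteratedFDeriv ℝ (2 + 1) F (m + t • h) (fun _ => h)‖ ≤ K * ‖h‖ ^ 3 := by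
      refine (ContinuousMultilinearMap.le_opNorm _ _).trans ?_
      simp only [Finset.prod_const, Finset.card_univ, Fintype.card_fin]
      gcongr
      exact hK 3 le_rfl _
    calc _ ≤ 1 * (K * ‖h‖ ^ 3) := by gcongr
      _ = _ := one_mul _
  have hE : F (m + h) - (F m + fderiv ℝ F m h + 2⁻¹ * fderiv ℝ (fderiv ℝ F) m h h)
      = 2⁻¹ * ∫ t in (0:ℝ)..1, (1 - t) ^ 2 • iteratedFDeriv ℝ (2 + 1) F (m + t • h) (fun _ => h) := by
    rw [key]
    simp [Nat.factorial]
  rw [hE, abs_mul]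
  rw [Real.norm_eq_abs] at hI
  have : |(2:ℝ)⁻¹| ≤ 1 := by norm_num
  calc _ ≤ 1 * (K * ‖h‖ ^ 3 * |1 - 0|) := by gcongr
    _ = _ := by simp

/-- A function with nonnegative second differences in the directions `a` and `b` has a
nonnegative mixed second derivative. -/
theorem BddContDiff.mixed_deriv_nonneg {F : E → ℝ} (hF : BddContDiff F) (m a b : E)
    (hab : ∀ t : ℝ, 0 ≤ t → F (m + t • a) + F (m + t • b) ≤ F (m + t • (a + b)) + F m) :
    0 ≤ fderiv ℝ (fderiv ℝ F) m a b + fderiv ℝ (fderiv ℝ F) m b a := by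
  obtain ⟨K, hK0, hK⟩ := hF.exists_taylor
  set q := fderiv ℝ (fderiv ℝ F) m a b + fderiv ℝ (fderiv ℝ F) m b a with hq
  set M := 2 * K * (‖a‖ ^ 3 + ‖b‖ ^ 3 + ‖a + b‖ ^ 3) with hM
  -- In the second difference at scale `t` the linear and pure quadratic terms cancel, leaving `t² q
  -- / 2` up to `O(t³)`; divide by `t²` and let `t → 0`.
  have key : ∀ t : ℝ, 0 < t → -(M * t) ≤ q := by
    intro t ht
    have h1 := abs_le.1 (hK m (t • a))
    have h2 := abs_le.1 (hK m (t • b))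
    have h3 := abs_le.1 (hK m (t • (a + b)))
    have h4 := hab t ht.le
    simp only [map_smul, map_add, _root_.smul_apply, _root_.add_apply,
      smul_eq_mul, norm_smul, Real.norm_eq_abs, abs_of_pos ht, mul_pow] at h1 h2 h3
    have : -(M * t) * t ^ 2 ≤ q * t ^ 2 := by
      rw [hM, hq]
      nlinarith [h1.1, h2.1, h3.2]
    exact le_of_mul_le_mul_right this (by positivity)
  have hlim : Filter.Tendsto (fun t : ℝ => -(M * t)) (nhdsWithin 0 (Set.Ioi 0)) (nhds 0) := by
    have : Filter.Tendsto (fun t : ℝ => -(M * t)) (nhds 0) (nhds (-(M * 0))) :=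
      (continuous_const.mul continuous_id).neg.tendsto 0
    simpa using this.mono_left nhdsWithin_le_nhds
  exact le_of_tendsto hlim (Filter.eventually_of_mem self_mem_nhdsWithin fun t ht => key t ht)

end BoundedDerivatives

/-! ### One Lindeberg replacement step. -/

section Replacement

variable {ι : Type*} [Fintype ι]

theorem MeasureTheory.MemLp.integrable_coord {μ : Measure (ι → ℝ)} [IsFiniteMeasure μ]
    (h : MemLp id 3 μ) (i : ι) : Integrable (fun x => x i) μ :=
  ((ContinuousLinearMap.proj (R := ℝ) (φ := fun _ : ι => ℝ) i).comp_memLp' h).integrable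
    (by norm_num)

theorem MeasureTheory.MemLp.integrable_coord_mul {μ : Measure (ι → ℝ)} [IsFiniteMeasure μ]
    (h : MemLp id 3 μ) (i j : ι) : Integrable (fun x => x i * x j) μ := by
  have h2 : MemLp id 2 μ := h.mono_exponent (by norm_num)
  exact ((ContinuousLinearMap.proj (R := ℝ) (φ := fun _ : ι => ℝ) i).comp_memLp' h2).integrable_mul
    ((ContinuousLinearMap.proj (R := ℝ) (φ := fun _ : ι => ℝ) j).comp_memLp' h2)

variable [DecidableEq ι]

/-- `F` has nonnegative second differences in any two distinct coordinate directions. -/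
def HasNonnegMixedDifferences (F : (ι → ℝ) → ℝ) : Prop :=
  ∀ i j, i ≠ j → ∀ (m : ι → ℝ) (t : ℝ), 0 ≤ t →
    F (m + t • Pi.single i 1) + F (m + t • Pi.single j 1)
      ≤ F (m + t • (Pi.single i 1 + Pi.single j 1)) + F m

theorem ContinuousLinearMap.bilin_apply_eq_sum (B : (ι → ℝ) →L[ℝ] (ι → ℝ) →L[ℝ] ℝ) (x : ι → ℝ) :
    B x x = ∑ i, ∑ j, x i * x j * B (Pi.single i 1) (Pi.single j 1) := by
  have hx : x = ∑ i, x i • (Pi.single i 1 : ι → ℝ) := pi_eq_sum_univ' x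
  conv_lhs => rw [hx]
  simp only [map_sum, map_smul, _root_.sum_apply, _root_.smul_apply, smul_eq_mul,
    Finset.mul_sum]
  rw [Finset.sum_comm]
  exact Finset.sum_congr rfl fun i _ => Finset.sum_congr rfl fun j _ => by ring

/-- Integrating the Taylor expansion kills the linear term because the measure is centred, and turns
the quadratic term into a pairing of covariances with the Hessian. -/
theorem abs_integral_sub_taylor_le {F : (ι → ℝ) → ℝ} (hF : BddContDiff F) {K : ℝ}
    (hK : ∀ m h, |F (m + h) - (F m + fderiv ℝ F m h + 2⁻¹ * fderiv ℝ (fderiv ℝ F) m h h)|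
      ≤ K * ‖h‖ ^ 3) {μ : Measure (ι → ℝ)} [IsProbabilityMeasure μ] (h3 : MemLp id 3 μ)
    (h1 : ∀ i, ∫ x, x i ∂μ = 0) (m : ι → ℝ) {ε : ℝ} (hε : 0 ≤ ε) :
    |∫ x, F (m + ε • x) ∂μ - (F m + 2⁻¹ * ε ^ 2 * ∑ i, ∑ j, (∫ x, x i * x j ∂μ) *
        fderiv ℝ (fderiv ℝ F) m (Pi.single i 1) (Pi.single j 1))|
      ≤ K * (∫ x, ‖x‖ ^ 3 ∂μ) * ε ^ 3 := by
  set B := fderiv ℝ (fderiv ℝ F) m with hB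
  have hn : Integrable (fun x : ι → ℝ => ‖x‖ ^ 3) μ := by
    simpa using h3.integrable_norm_pow (p := 3) (by norm_num)
  have hid : Integrable (fun x : ι → ℝ => x) μ := h3.integrable (by norm_num)
  have hL : ∫ x, fderiv ℝ F m x ∂μ = 0 := by
    rw [ContinuousLinearMap.integral_comp_comm _ hid]
    have : ∫ x : ι → ℝ, x ∂μ = 0 := by
      ext i
      rw [eval_integral fun i => h3.integrable_coord i]
      exact h1 i
    rw [this, map_zero]
  have hLi : Integrable (fun x => fderiv ℝ F m x) μ := (fderiv ℝ F m).integrable_comp hid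
  have hQi : Integrable (fun x : ι → ℝ => B x x) μ := by
    simp_rw [ContinuousLinearMap.bilin_apply_eq_sum B]
    exact integrable_finsetSum _ fun i _ => integrable_finsetSum _ fun j _ =>
      (h3.integrable_coord_mul i j).mul_const _
  have hQ : ∫ x : ι → ℝ, B x x ∂μ =
      ∑ i, ∑ j, (∫ x, x i * x j ∂μ) * B (Pi.single i 1) (Pi.single j 1) := by
    simp_rw [ContinuousLinearMap.bilin_apply_eq_sum B]
    rw [integral_finsetSum _ fun i _ => integrable_finsetSum _ fun j _ =>
      (h3.integrable_coord_mul i j).mul_const _]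
    refine Finset.sum_congr rfl fun i _ => ?_
    rw [integral_finsetSum _ fun j _ => (h3.integrable_coord_mul i j).mul_const _]
    exact Finset.sum_congr rfl fun j _ => integral_mul_const _ _
  have hFi : Integrable (fun x => F (m + ε • x)) μ := by
    obtain ⟨cF, M, hM⟩ := hF
    have := cF.continuous
    refine Integrable.of_bound (C := M) (Continuous.aestronglyMeasurable (by fun_prop))
      (ae_of_all _ fun x => ?_)
    simpa using hM 0 (by norm_num) (m + ε • x)
  have e : ∫ x, F (m + ε • x) ∂μ - (F m + 2⁻¹ * ε ^ 2 * ∑ i, ∑ j, (∫ x, x i * x j ∂μ) *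
        B (Pi.single i 1) (Pi.single j 1))
      = ∫ x, (F (m + ε • x) - (F m + ε * fderiv ℝ F m x + 2⁻¹ * ε ^ 2 * B x x)) ∂μ := by
    have hA : Integrable (fun x => F m + ε * fderiv ℝ F m x) μ :=
      (integrable_const _).add (hLi.const_mul ε)
    have hB : Integrable (fun x => 2⁻¹ * ε ^ 2 * B x x) μ := hQi.const_mul _
    have hAB : Integrable (fun x => F m + ε * fderiv ℝ F m x + 2⁻¹ * ε ^ 2 * B x x) μ := hA.add hB
    rw [integral_sub hFi hAB, integral_add hA hB, integral_add (integrable_const _)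
      (hLi.const_mul ε), integral_const_mul, integral_const_mul, hL, hQ]
    simp
  rw [e, ← Real.norm_eq_abs]
  calc _ ≤ ∫ x, K * ‖x‖ ^ 3 * ε ^ 3 ∂μ := by
        refine norm_integral_le_of_norm_le ((hn.const_mul K).mul_const _) (ae_of_all _ fun x => ?_)
        have := hK m (ε • x)
        simp only [map_smul, _root_.smul_apply, smul_eq_mul, norm_smul, Real.norm_eq_abs,
          abs_of_nonneg hε, ← hB] at this
        rw [Real.norm_eq_abs]
        rw [show 2⁻¹ * ε ^ 2 * B x x = 2⁻¹ * (ε * (ε * B x x)) by ring]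
        exact this.trans_eq (by ring)
    _ = _ := by rw [integral_mul_const, integral_const_mul]

/-- Replacing one small vector by another one with larger covariances increases the expectation
of a smooth function with nonnegative mixed differences, up to a third order error. -/
theorem BddContDiff.exists_integral_smul_le {F : (ι → ℝ) → ℝ} (hF : BddContDiff F)
    (hS : HasNonnegMixedDifferences F) {μ ν : Measure (ι → ℝ)} [IsProbabilityMeasure μ]
    [IsProbabilityMeasure ν] (hμ3 : MemLp id 3 μ) (hν3 : MemLp id 3 ν)
    (hμ1 : ∀ i, ∫ x, x i ∂μ = 0) (hν1 : ∀ i, ∫ x, x i ∂ν = 0)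
    (hdiag : ∀ i, ∫ x, x i * x i ∂μ = ∫ x, x i * x i ∂ν)
    (hoff : ∀ i j, ∫ x, x i * x j ∂μ ≤ ∫ x, x i * x j ∂ν) :
    ∃ K, 0 ≤ K ∧ ∀ (m : ι → ℝ) (ε : ℝ), 0 ≤ ε →
      ∫ x, F (m + ε • x) ∂μ ≤ ∫ x, F (m + ε • x) ∂ν + K * ε ^ 3 := by
  obtain ⟨K, hK0, hK⟩ := hF.exists_taylor
  refine ⟨K * (∫ x, ‖x‖ ^ 3 ∂μ) + K * (∫ x, ‖x‖ ^ 3 ∂ν),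
    add_nonneg (mul_nonneg hK0 (integral_nonneg fun x => by positivity))
      (mul_nonneg hK0 (integral_nonneg fun x => by positivity)), fun m ε hε => ?_⟩
  have h1 := abs_le.1 (abs_integral_sub_taylor_le hF hK hμ3 hμ1 m hε)
  have h2 := abs_le.1 (abs_integral_sub_taylor_le hF hK hν3 hν1 m hε)
  set B := fderiv ℝ (fderiv ℝ F) m with hB
  set q : ι → ι → ℝ := fun i j => B (Pi.single i 1) (Pi.single j 1) with hq
  have hsum : ∑ i, ∑ j, (∫ x, x i * x j ∂μ) * q i j ≤ ∑ i, ∑ j, (∫ x, x i * x j ∂ν) * q i j := by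
    -- The sign information concerns `q i j + q j i`, so the sum is symmetrised using the symmetry
    -- of the covariances.
    have swap : ∀ ρ : Measure (ι → ℝ), ∑ i, ∑ j, (∫ x, x i * x j ∂ρ) * q i j
        = 2⁻¹ * ∑ i, ∑ j, (∫ x, x i * x j ∂ρ) * (q i j + q j i) := by
      intro ρ
      have : ∑ i, ∑ j, (∫ x, x i * x j ∂ρ) * q i j = ∑ i, ∑ j, (∫ x, x i * x j ∂ρ) * q j i := by
        rw [Finset.sum_comm]
        simp_rw [mul_comm (_ : ℝ) (_ : ℝ)]
      simp_rw [mul_add, Finset.sum_add_distrib]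
      rw [← this]
      ring
    rw [swap μ, swap ν]
    gcongr 2⁻¹ * ?_
    refine Finset.sum_le_sum fun i _ => Finset.sum_le_sum fun j _ => ?_
    by_cases hij : i = j
    · subst hij
      rw [hdiag]
    · exact mul_le_mul_of_nonneg_right (hoff i j)
        (hF.mixed_deriv_nonneg m _ _ fun t ht => hS i j hij m t ht)
  have := mul_le_mul_of_nonneg_left hsum (by positivity : 0 ≤ 2⁻¹ * ε ^ 2)
  nlinarith [h1.2, h2.1]

end Replacement

/-! ### Slepian's comparison for smooth functions. -/

section Comparison

/-- The product of a centred Gaussian measure with itself is rotation invariant; rotate by the angle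
whose cosine is `√(p / (p + s))`. This splits off an independent piece of variance share `s`. -/
theorem integral_map_smul_add_smul {E : Type*} [NormedAddCommGroup E] [NormedSpace ℝ E]
    [MeasurableSpace E] [BorelSpace E] [SecondCountableTopology E] [CompleteSpace E]
    {μ : Measure E} [IsGaussian μ] (hμ : μ[id] = 0) {H : E → ℝ} (hH : Continuous H)
    {M : ℝ} (hM : ∀ x, |H x| ≤ M) {p s : ℝ} (hp : 0 ≤ p) (hs : 0 ≤ s) :
    ∫ x, H (√(p + s) • x) ∂μ = ∫ x, ∫ y, H (√p • x + √s • y) ∂μ ∂μ := by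
  obtain ⟨θ, hc, hsn⟩ : ∃ θ, √(p + s) * Real.cos θ = √p ∧ √(p + s) * Real.sin θ = √s := by
    rcases (add_nonneg hp hs).eq_or_lt with h | h
    · have hp' : p = 0 := by linarith
      have hs' : s = 0 := by linarith
      exact ⟨0, by simp [hp', hs'], by simp [hp', hs']⟩
    · refine ⟨Real.arccos (√(p / (p + s))), ?_, ?_⟩
      · rw [Real.cos_arccos (by linarith [Real.sqrt_nonneg (p / (p + s))])
          (Real.sqrt_le_one.2 (by rw [div_le_one h]; linarith)), ← Real.sqrt_mul h.le]
        congr 1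
        field_simp
      · rw [Real.sin_arccos, Real.sq_sqrt (by positivity), ← Real.sqrt_mul h.le]
        congr 1
        field_simp
        ring
  have hint : Integrable (fun z : E × E => H (√p • z.1 + √s • z.2)) (μ.prod μ) :=
    Integrable.of_bound (Continuous.aestronglyMeasurable (by fun_prop)) M
      (ae_of_all _ fun z => hM _)
  calc ∫ x, H (√(p + s) • x) ∂μ
      = ∫ z : E × E, H (√(p + s) • z.1) ∂(μ.prod μ) := by
        have := integral_fun_fst (μ := μ) (ν := μ) (fun x => H (√(p + s) • x))
        simpa using this.symm
    _ = ∫ z : E × E, H (√(p + s) • z.1) ∂((μ.prod μ).map (ContinuousLinearMap.rotation θ)) := by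
        rw [IsGaussian.map_rotation_eq_self hμ]
    _ = ∫ z : E × E, H (√p • z.1 + √s • z.2) ∂(μ.prod μ) := by
        rw [integral_map (by fun_prop) (Continuous.aestronglyMeasurable (by fun_prop))]
        simp only [ContinuousLinearMap.rotation_apply, smul_add, smul_smul, hc, hsn]
    _ = _ := integral_prod _ hint

variable {ι : Type*} [Fintype ι] [DecidableEq ι]

/-- Slepian's comparison inequality for smooth functions. -/
theorem BddContDiff.integral_le_of_covariance_le {F : (ι → ℝ) → ℝ} (hF : BddContDiff F)
    (hS : HasNonnegMixedDifferences F) {μ ν : Measure (ι → ℝ)} [IsGaussian μ]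
    [IsGaussian ν] (hμ1 : ∀ i, ∫ x, x i ∂μ = 0) (hν1 : ∀ i, ∫ x, x i ∂ν = 0)
    (hdiag : ∀ i, ∫ x, x i * x i ∂μ = ∫ x, x i * x i ∂ν)
    (hoff : ∀ i j, ∫ x, x i * x j ∂μ ≤ ∫ x, x i * x j ∂ν) :
    ∫ x, F x ∂μ ≤ ∫ x, F x ∂ν := by
  have hμ3 : MemLp id 3 μ := IsGaussian.memLp_id μ 3 (by norm_num)
  have hν3 : MemLp id 3 ν := IsGaussian.memLp_id ν 3 (by norm_num)
  have mean : ∀ ρ : Measure (ι → ℝ), [IsProbabilityMeasure ρ] → MemLp id 3 ρ →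
      (∀ i, ∫ x, x i ∂ρ = 0) → ρ[id] = 0 := by
    intro ρ _ h3 h1
    ext i
    simp only [id]
    rw [eval_integral fun i => h3.integrable_coord i]
    exact h1 i
  obtain ⟨K, hK0, hK⟩ := hF.exists_integral_smul_le hS hμ3 hν3 hμ1 hν1 hdiag hoff
  have hFc : Continuous F := hF.1.continuous
  obtain ⟨M, hM'⟩ := hF.2
  have hM : ∀ x, |F x| ≤ M := fun x => by simpa using hM' 0 (by norm_num) x
  -- Interpolation between `Ψ 1 0`, the integral against `μ`, and `Ψ 0 1`, the integral against `ν`.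
  set Ψ : ℝ → ℝ → ℝ := fun p q => ∫ z, F (√p • z.1 + √q • z.2) ∂(μ.prod ν) with hΨ
  have hint : ∀ {H : (ι → ℝ) × (ι → ℝ) → ℝ}, Continuous H → (∀ z, |H z| ≤ M) →
      Integrable H (μ.prod ν) := fun hc hb =>
    Integrable.of_bound hc.aestronglyMeasurable M (ae_of_all _ hb)
  have hcont : ∀ (ρ : Measure (ι → ℝ)) [IsProbabilityMeasure ρ] (ε : ℝ),
      Continuous (fun m => ∫ x, F (m + ε • x) ∂ρ) := by
    intro ρ _ ε
    refine continuous_of_dominated (bound := fun _ => M)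
      (fun m => Continuous.aestronglyMeasurable (by fun_prop)) (fun m => ae_of_all _ fun x => hM _)
      (integrable_const _) (ae_of_all _ fun x => by fun_prop)
  have hbdd : ∀ (ρ : Measure (ι → ℝ)) [IsProbabilityMeasure ρ] (ε : ℝ) (m : ι → ℝ),
      |∫ x, F (m + ε • x) ∂ρ| ≤ M := by
    intro ρ _ ε m
    have := norm_integral_le_of_norm_le_const (μ := ρ) (f := fun x => F (m + ε • x))
      (ae_of_all _ fun x => hM _)
    simpa using this
  -- Both sides average over the same base point `√p • z.1 + √q • z.2`; they differ only in the law
  -- of the extra piece of size `√s`.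
  have step : ∀ p q s, 0 ≤ p → 0 ≤ q → 0 ≤ s → Ψ (p + s) q ≤ Ψ p (q + s) + K * √s ^ 3 := by
    intro p q s hp hq hs
    have hi1 : Integrable (fun z : (ι → ℝ) × (ι → ℝ) =>
        ∫ x, F (√p • z.1 + √q • z.2 + √s • x) ∂μ) (μ.prod ν) :=
      hint ((hcont μ (√s)).comp (by fun_prop)) fun _ => hbdd μ _ _
    have hi2 : Integrable (fun z : (ι → ℝ) × (ι → ℝ) =>
        ∫ x, F (√p • z.1 + √q • z.2 + √s • x) ∂ν) (μ.prod ν) :=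
      hint ((hcont ν (√s)).comp (by fun_prop)) fun _ => hbdd ν _ _
    have e1 : Ψ (p + s) q = ∫ z, ∫ x, F (√p • z.1 + √q • z.2 + √s • x) ∂μ ∂(μ.prod ν) := by
      rw [hΨ]
      simp only
      rw [integral_prod_symm _ (hint (by fun_prop) fun _ => hM _), integral_prod_symm _ hi1]
      refine integral_congr_ae (ae_of_all _ fun y => ?_)
      have := integral_map_smul_add_smul (mean μ hμ3 hμ1) (H := fun x => F (x + √q • y))
        (by fun_prop) (fun x => hM _) hp hs
      simp only at this ⊢
      rw [this]
      simp_rw [add_right_comm]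
    have e2 : Ψ p (q + s) = ∫ z, ∫ x, F (√p • z.1 + √q • z.2 + √s • x) ∂ν ∂(μ.prod ν) := by
      rw [hΨ]
      simp only
      rw [integral_prod _ (hint (by fun_prop) fun _ => hM _), integral_prod _ hi2]
      refine integral_congr_ae (ae_of_all _ fun y => ?_)
      have := integral_map_smul_add_smul (mean ν hν3 hν1) (H := fun x => F (√p • y + x))
        (by fun_prop) (fun x => hM _) hq hs
      simp only at this ⊢
      rw [this]
      simp_rw [add_assoc]
    rw [e1, e2]
    calc _ ≤ ∫ z : (ι → ℝ) × (ι → ℝ), (∫ x, F (√p • z.1 + √q • z.2 + √s • x) ∂ν + K * √s ^ 3)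
          ∂(μ.prod ν) :=
          integral_mono hi1 (hi2.add (integrable_const _)) fun z => hK _ _ (Real.sqrt_nonneg _)
      _ = _ := by
          rw [integral_add hi2 (integrable_const _)]
          simp
  have iter : ∀ (n : ℕ) (q s : ℝ), 0 ≤ q → 0 ≤ s →
      Ψ (n * s) q ≤ Ψ 0 (q + n * s) + n * (K * √s ^ 3) := by
    intro n
    induction n with
    | zero => intro q s hq hs; simp
    | succ n ih =>
      intro q s hq hs
      have h1 := step (n * s) q s (by positivity) hq hs
      have h2 := ih (q + s) s (by positivity) hs
      push_cast
      rw [show ((n : ℝ) + 1) * s = n * s + s by ring,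
        show q + (n * s + s) = q + s + n * s by ring]
      linarith
  have hΨ1 : Ψ 1 0 = ∫ x, F x ∂μ := by
    have := integral_fun_fst (μ := μ) (ν := ν) F
    simpa [hΨ] using this
  have hΨ2 : Ψ 0 1 = ∫ x, F x ∂ν := by
    have := integral_fun_snd (μ := μ) (ν := ν) F
    simpa [hΨ] using this
  -- With `n + 1` steps of size `s = 1 / (n + 1)`, the errors `K s^(3/2)` add up to `K √s`.
  have bound : ∀ n : ℕ, ∫ x, F x ∂μ ≤ ∫ x, F x ∂ν + K * √(1 / ((n : ℝ) + 1)) := by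
    intro n
    have h := iter (n + 1) 0 (1 / ((n : ℝ) + 1)) le_rfl (by positivity)
    have hn : ((n + 1 : ℕ) : ℝ) * (1 / ((n : ℝ) + 1)) = 1 := by
      push_cast
      field_simp
    rw [hn, zero_add, hΨ1, hΨ2] at h
    have h3 : ((n + 1 : ℕ) : ℝ) * (K * √(1 / ((n : ℝ) + 1)) ^ 3) = K * √(1 / ((n : ℝ) + 1)) := by
      have : √(1 / ((n : ℝ) + 1)) ^ 3 = 1 / ((n : ℝ) + 1) * √(1 / ((n : ℝ) + 1)) := by
        rw [pow_succ, Real.sq_sqrt (by positivity)]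
      rw [this]
      linear_combination K * √(1 / ((n : ℝ) + 1)) * hn
    linarith
  have lim : Filter.Tendsto (fun n : ℕ => ∫ x, F x ∂ν + K * √(1 / ((n : ℝ) + 1))) Filter.atTop
      (nhds (∫ x, F x ∂ν)) := by
    have := (tendsto_one_div_add_atTop_nhds_zero_nat (𝕜 := ℝ)).sqrt
    simpa using (this.const_mul K).const_add (∫ x, F x ∂ν)
  exact ge_of_tendsto' lim bound

end Comparison

/-! ### Slepian's inequality for orthant events. -/

section Slepian

/-- The function is locally constant off the compact interval `[b - 1, b]`, on which the continuous
derivatives are bounded. -/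
theorem bddContDiff_smoothTransition_sub (b : ℝ) :
    BddContDiff (fun y : ℝ => Real.smoothTransition (b - y)) := by
  have hc : ContDiff ℝ 3 (fun y : ℝ => Real.smoothTransition (b - y)) :=
    (Real.smoothTransition.contDiff (n := 3)).comp (contDiff_const.sub contDiff_id)
  refine ⟨hc, ?_⟩
  have bound : ∀ i : ℕ, i ≤ 3 → ∃ K : ℝ, ∀ x,
      ‖iteratedFDeriv ℝ i (fun y : ℝ => Real.smoothTransition (b - y)) x‖ ≤ K := by
    intro i hi
    obtain ⟨K, hK⟩ := (isCompact_Icc (a := b - 1) (b := b)).exists_bound_of_continuousOn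
      (hc.continuous_iteratedFDeriv (m := i) (by exact_mod_cast hi)).continuousOn
    have hconst : ∀ c x : ℝ, |c| ≤ 1 → ‖iteratedFDeriv ℝ i (fun _ : ℝ => c) x‖ ≤ 1 := by
      intro c x h
      rcases Nat.eq_zero_or_pos i with rfl | h0
      · simpa using h
      · rw [iteratedFDeriv_const_of_ne h0.ne']
        simp
    refine ⟨max K 1, fun x => ?_⟩
    by_cases h1 : x < b - 1
    · have : (fun y : ℝ => Real.smoothTransition (b - y)) =ᶠ[nhds x] fun _ => 1 := by
        filter_upwards [Iio_mem_nhds h1] with y hy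
        exact Real.smoothTransition.one_of_one_le (by simp at hy; linarith)
      rw [(this.iteratedFDeriv ℝ i).self_of_nhds]
      exact (hconst 1 x (by simp)).trans (le_max_right _ _)
    by_cases h2 : b < x
    · have : (fun y : ℝ => Real.smoothTransition (b - y)) =ᶠ[nhds x] fun _ => 0 := by
        filter_upwards [Ioi_mem_nhds h2] with y hy
        exact Real.smoothTransition.zero_of_nonpos (by simp at hy; linarith)
      rw [(this.iteratedFDeriv ℝ i).self_of_nhds]
      exact (hconst 0 x (by simp)).trans (le_max_right _ _)
    · exact (hK x ⟨not_lt.1 h1, not_lt.1 h2⟩).trans (le_max_left _ _)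
  choose! K hK using bound
  refine ⟨∑ i ∈ Finset.range 4, |K i|, fun i hi x => (hK i hi x).trans ((le_abs_self _).trans ?_)⟩
  exact Finset.single_le_sum (f := fun i => |K i|) (fun _ _ => abs_nonneg _)
    (Finset.mem_range.2 (by omega))

variable {ι : Type*} [Fintype ι] [DecidableEq ι]

/-- The second difference factors as the product of the decrements of `f i` and `f j` with the
untouched factors, all nonnegative. -/
theorem hasNonnegMixedDifferences_prod {f : ι → ℝ → ℝ} (hf : ∀ i, Antitone (f i))
    (h0 : ∀ i x, 0 ≤ f i x) : HasNonnegMixedDifferences (fun x => ∏ i, f i (x i)) := by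
  intro i j hij m t ht
  have hj : j ∈ Finset.univ.erase i := by simp [hij.symm]
  have split : ∀ x : ι → ℝ, ∏ k, f k (x k)
      = f i (x i) * (f j (x j) * ∏ k ∈ (Finset.univ.erase i).erase j, f k (x k)) := by
    intro x
    rw [Finset.mul_prod_erase _ (fun k => f k (x k)) hj,
      Finset.mul_prod_erase _ (fun k => f k (x k)) (Finset.mem_univ i)]
  simp only [split]
  have rest : ∀ x : ι → ℝ, (∀ k, k ≠ i → k ≠ j → x k = m k) →
      ∏ k ∈ (Finset.univ.erase i).erase j, f k (x k)
        = ∏ k ∈ (Finset.univ.erase i).erase j, f k (m k) := by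
    intro x hx
    refine Finset.prod_congr rfl fun k hk => ?_
    simp only [Finset.mem_erase] at hk
    rw [hx k hk.2.1 hk.1]
  rw [rest (m + t • Pi.single i 1) (fun k h1 h2 => by simp [h1]),
    rest (m + t • Pi.single j 1) (fun k h1 h2 => by simp [h2]),
    rest (m + t • (Pi.single i 1 + Pi.single j 1)) (fun k h1 h2 => by simp [h1, h2])]
  have hR : 0 ≤ ∏ k ∈ (Finset.univ.erase i).erase j, f k (m k) :=
    Finset.prod_nonneg fun k _ => h0 k _
  simp only [Pi.add_apply, Pi.smul_apply, Pi.single_eq_same, smul_eq_mul, mul_one,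
    Pi.single_eq_of_ne hij, Pi.single_eq_of_ne hij.symm, mul_zero, add_zero, zero_add]
  have hi' : f i (m i + t) ≤ f i (m i) := hf i (by linarith)
  have hj' : f j (m j + t) ≤ f j (m j) := hf j (by linarith)
  have := mul_nonneg (mul_nonneg (sub_nonneg.2 hi') (sub_nonneg.2 hj')) hR
  nlinarith

/-- Slepian's inequality for Gaussian measures, with a margin `δ` in the barrier. -/
theorem real_forall_le_sub_le_of_covariance_le {μ ν : Measure (ι → ℝ)} [IsGaussian μ]
    [IsGaussian ν] (hμ1 : ∀ i, ∫ x, x i ∂μ = 0) (hν1 : ∀ i, ∫ x, x i ∂ν = 0)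
    (hdiag : ∀ i, ∫ x, x i * x i ∂μ = ∫ x, x i * x i ∂ν)
    (hoff : ∀ i j, ∫ x, x i * x j ∂μ ≤ ∫ x, x i * x j ∂ν) (a : ι → ℝ) {δ : ℝ} (hδ : 0 < δ) :
    μ.real {x | ∀ i, x i ≤ a i - δ} ≤ ν.real {x | ∀ i, x i ≤ a i} := by
  -- A smooth cutoff equal to `1` for `y ≤ a i - δ` and `0` for `y ≥ a i`, so the product lies
  -- between the two indicators.
  set f : ι → ℝ → ℝ := fun i y => Real.smoothTransition (a i / δ - δ⁻¹ * y) with hf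
  have hfe : ∀ i y, f i y = Real.smoothTransition ((a i - y) / δ) := by
    intro i y
    simp only [hf]
    congr 1
    field_simp
  have hF : BddContDiff (fun x : ι → ℝ => ∏ i, f i (x i)) := by
    refine BddContDiff.prod (F := fun i (x : ι → ℝ) => f i (x i)) _ fun i => ?_
    have := (bddContDiff_smoothTransition_sub (a i / δ)).comp_clm
      (δ⁻¹ • ContinuousLinearMap.proj (R := ℝ) (φ := fun _ : ι => ℝ) i)
    simpa [hf] using this
  have hS : HasNonnegMixedDifferences (fun x : ι → ℝ => ∏ i, f i (x i)) := by
    refine hasNonnegMixedDifferences_prod (fun i x y hxy => ?_)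
      fun i x => Real.smoothTransition.nonneg _
    refine Real.smoothTransition.monotone ?_
    have := mul_le_mul_of_nonneg_left hxy (inv_nonneg.2 hδ.le)
    linarith
  have key := hF.integral_le_of_covariance_le hS hμ1 hν1 hdiag hoff
  have meas : ∀ b : ι → ℝ, MeasurableSet {x : ι → ℝ | ∀ i, x i ≤ b i} := fun b =>
    measurableSet_setOfPred.2 (by fun_prop)
  have hlow : μ.real {x | ∀ i, x i ≤ a i - δ} ≤ ∫ x, ∏ i, f i (x i) ∂μ := by
    rw [← integral_indicator_one (meas fun i => a i - δ)]
    refine integral_mono ((integrable_const 1).indicator (meas _)) (hF.integrable μ) fun x => ?_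
    by_cases hx : x ∈ {x : ι → ℝ | ∀ i, x i ≤ a i - δ}
    · rw [Set.indicator_of_mem hx]
      refine le_of_eq (Finset.prod_eq_one fun i _ => ?_).symm
      rw [hfe]
      refine Real.smoothTransition.one_of_one_le ?_
      rw [le_div_iff₀ hδ]
      linarith [hx i]
    · rw [Set.indicator_of_notMem hx]
      exact Finset.prod_nonneg fun i _ => Real.smoothTransition.nonneg _
  have hupp : ∫ x, ∏ i, f i (x i) ∂ν ≤ ν.real {x | ∀ i, x i ≤ a i} := by
    rw [← integral_indicator_one (meas a)]
    refine integral_mono (hF.integrable ν) ((integrable_const 1).indicator (meas _)) fun x => ?_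
    by_cases hx : x ∈ {x : ι → ℝ | ∀ i, x i ≤ a i}
    · rw [Set.indicator_of_mem hx]
      exact Finset.prod_le_one (fun i _ => Real.smoothTransition.nonneg _)
        fun i _ => Real.smoothTransition.le_one _
    · rw [Set.indicator_of_notMem hx]
      simp only [Set.mem_ofPred_eq, not_forall, not_le] at hx
      obtain ⟨i, hi⟩ := hx
      refine le_of_eq (Finset.prod_eq_zero (Finset.mem_univ i) ?_)
      rw [hfe]
      exact Real.smoothTransition.zero_of_nonpos
        (div_nonpos_of_nonpos_of_nonneg (by linarith) hδ.le)
  linarith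

end Slepian

/-! ### Gaussian random walks and Lévy's inequality. -/

section GaussianWalk

/-- The standard Gaussian measure on `ι → ℝ`. -/
noncomputable abbrev piGaussian (ι : Type*) [Fintype ι] : Measure (ι → ℝ) :=
  Measure.pi fun _ => gaussianReal 0 1

instance isGaussian_piGaussian (ι : Type*) [Fintype ι] : IsGaussian (piGaussian ι) := by
  have h : iIndepFun (fun (i : ι) (x : ι → ℝ) => x i) (piGaussian ι) :=
    iIndepFun_pi (X := fun _ y => y) fun i => by fun_prop
  have h2 := h.hasGaussianLaw fun i => ⟨by
    rw [(measurePreserving_eval (fun _ : ι => gaussianReal 0 1) i).map_eq]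
    infer_instance⟩
  have := h2.isGaussian_map
  have e : (fun (x : ι → ℝ) => fun i => x i) = id := rfl
  rwa [e, Measure.map_id] at this

theorem map_sum_mul_piGaussian {ι : Type*} [Fintype ι] (σ : ι → ℝ) :
    (piGaussian ι).map (fun g => ∑ k, σ k * g k)
      = gaussianReal 0 (∑ k, σ k ^ 2).toNNReal := by
  set T : (ι → ℝ) →L[ℝ] ℝ :=
    ∑ k, σ k • ContinuousLinearMap.proj (R := ℝ) (φ := fun _ : ι => ℝ) k with hT
  have hTe : (fun g : ι → ℝ => ∑ k, σ k * g k) = T := by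
    ext g
    simp [hT]
  have hmean : ∫ g, (∑ k, σ k * g k) ∂(piGaussian ι) = 0 := by
    rw [integral_finsetSum _ fun k _ =>
      ((integrable_eval (i := k) IsGaussian.integrable_id).const_mul _)]
    refine Finset.sum_eq_zero fun k _ => ?_
    rw [integral_const_mul, integral_eval, integral_id_gaussianReal, mul_zero]
  have hvar : Var[fun g : ι → ℝ => ∑ k, σ k * g k; piGaussian ι] = ∑ k, σ k ^ 2 := by
    have e : (fun g : ι → ℝ => ∑ k, σ k * g k) = ∑ k, fun g : ι → ℝ => σ k * g k := by
      ext g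
      simp
    rw [e, variance_sum_pi (X := fun k y => σ k * y)
      fun i => IsGaussian.memLp_two_id.const_mul _]
    change ∑ i, Var[fun x ↦ σ i * (id x); gaussianReal 0 1] = _
    simp_rw [variance_const_mul, variance_id_gaussianReal]
    simp
  have := IsGaussian.map_eq_gaussianReal (μ := piGaussian ι) T
  rw [← hTe, hvar, hmean] at this
  exact this

theorem gaussianReal_real_Iic_of_neg {v : NNReal} {y : ℝ} (hy : y < 0) :
    2 * (gaussianReal 0 v).real (Set.Iic y) ≤ 1 := by
  have h1 : (gaussianReal 0 v).real (Set.Iic y) = (gaussianReal 0 v).real (Set.Ici (-y)) := by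
    have := gaussianReal_map_neg (μ := 0) (v := v)
    rw [neg_zero] at this
    conv_lhs => rw [← this]
    rw [map_measureReal_apply (by fun_prop) measurableSet_Iic]
    congr 1
    ext z
    simp
  have h2 : Disjoint (Set.Iic y) (Set.Ici (-y)) := by
    rw [Set.disjoint_left]
    intro z hz hz'
    simp at hz hz'
    linarith
  have h3 := measureReal_union (μ := gaussianReal 0 v) h2 measurableSet_Ici
  have h4 : (gaussianReal 0 v).real (Set.Iic y ∪ Set.Ici (-y)) ≤ 1 := measureReal_le_one
  linarith

theorem piFinSuccAbove_symm_zero_apply {d : ℕ} (z : ℝ × (Fin d → ℝ)) :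
    (MeasurableEquiv.piFinSuccAbove (fun _ : Fin (d + 1) => ℝ) 0).symm z = Fin.cons z.1 z.2 := by
  simp [MeasurableEquiv.piFinSuccAbove, Fin.insertNthEquiv]

theorem measurable_fin_cons (d : ℕ) :
    Measurable (fun z : ℝ × (Fin d → ℝ) => (Fin.cons z.1 z.2 : Fin (d + 1) → ℝ)) := by
  simp_rw [← piFinSuccAbove_symm_zero_apply]
  exact MeasurableEquiv.measurable _

theorem piGaussian_real_succ {d : ℕ} {S : Set (Fin (d + 1) → ℝ)} (hS : MeasurableSet S) :
    (piGaussian (Fin (d + 1))).real S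
      = ∫ x, (piGaussian (Fin d)).real {g | (Fin.cons x g : Fin (d + 1) → ℝ) ∈ S}
          ∂(gaussianReal 0 1) := by
  have hmp := (measurePreserving_piFinSuccAbove (fun _ : Fin (d + 1) => gaussianReal 0 1) 0).symm
  have hpre : (MeasurableEquiv.piFinSuccAbove (fun _ : Fin (d + 1) => ℝ) 0).symm ⁻¹' S
      = {z | (Fin.cons z.1 z.2 : Fin (d + 1) → ℝ) ∈ S} := by
    ext z
    rw [Set.mem_preimage, piFinSuccAbove_symm_zero_apply, Set.mem_ofPred_eq]
  have hmeas : MeasurableSet {z : ℝ × (Fin d → ℝ) | (Fin.cons z.1 z.2 : Fin (d + 1) → ℝ) ∈ S} :=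
    measurable_fin_cons d hS
  rw [← hmp.measureReal_preimage hS.nullMeasurableSet, hpre, ← integral_indicator_one hmeas,
    integral_prod _ ((integrable_const 1).indicator hmeas)]
  refine integral_congr_ae (ae_of_all _ fun x => ?_)
  have hx : MeasurableSet {g : Fin d → ℝ | (Fin.cons x g : Fin (d + 1) → ℝ) ∈ S} :=
    (measurable_fin_cons d).comp measurable_prodMk_left hS
  simp only
  rw [← integral_indicator_one hx]
  rfl

/-- Lévy's inequality for a Gaussian random walk. -/
theorem two_mul_piGaussian_real_sub_one_le (d : ℕ) (σ : Fin d → ℝ) (a : ℝ) :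
    2 * (piGaussian (Fin d)).real {g | ∑ k, σ k * g k ≤ a} - 1
      ≤ (piGaussian (Fin d)).real {g | 0 ≤ a ∧ ∀ i, ∑ k ∈ Finset.Iic i, σ k * g k ≤ a} := by
  -- The induction conditions on the first increment `x`, leaving a shorter walk with barrier `a - σ
  -- 0 * x`. The clause `0 ≤ a` in the event then encodes the constraint at the first step. When the
  -- barrier is negative the event is empty, and symmetry makes the left side nonpositive.
  have trivial_of_neg : ∀ (d : ℕ) (σ : Fin d → ℝ) (a : ℝ), a < 0 →
      2 * (piGaussian (Fin d)).real {g | ∑ k, σ k * g k ≤ a} - 1 ≤ 0 := by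
    intro d σ a ha
    have := gaussianReal_real_Iic_of_neg (v := (∑ k, σ k ^ 2).toNNReal) ha
    rw [← map_sum_mul_piGaussian, map_measureReal_apply (by fun_prop) measurableSet_Iic] at this
    change 2 * (piGaussian (Fin d)).real {g | ∑ k, σ k * g k ≤ a} ≤ 1 at this
    linarith
  induction d generalizing a with
  | zero =>
    by_cases ha : 0 ≤ a
    · simp [ha]
      norm_num
    · simp [ha]
  | succ d ih =>
    by_cases ha : 0 ≤ a
    swap
    · exact (trivial_of_neg _ σ a (not_le.1 ha)).trans measureReal_nonneg
    have m1 : MeasurableSet {g : Fin (d + 1) → ℝ | ∑ k, σ k * g k ≤ a} :=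
      measurableSet_le (by fun_prop) (by fun_prop)
    have m2 : MeasurableSet {g : Fin (d + 1) → ℝ | 0 ≤ a ∧
        ∀ i, ∑ k ∈ Finset.Iic i, σ k * g k ≤ a} :=
      measurableSet_setOfPred.2 (by fun_prop)
    have mrec : ∀ {S : Set (Fin (d + 1) → ℝ)}, MeasurableSet S → Integrable (fun x =>
        (piGaussian (Fin d)).real {g | (Fin.cons x g : Fin (d + 1) → ℝ) ∈ S})
          (gaussianReal 0 1) := by
      intro S hS
      refine Integrable.of_bound (C := 1) ?_ (ae_of_all _ fun x => ?_)
      · exact (measurable_measure_prodMk_left (ν := piGaussian (Fin d))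
          (measurable_fin_cons d hS)).ennreal_toReal.aestronglyMeasurable
      · rw [Real.norm_eq_abs, abs_of_nonneg measureReal_nonneg]
        exact measureReal_le_one
    rw [piGaussian_real_succ m1, piGaussian_real_succ m2, ← integral_const_mul]
    have h1 : (1 : ℝ) = ∫ _ : ℝ, (1 : ℝ) ∂(gaussianReal 0 1) := by simp
    conv_lhs => rw [h1]
    rw [← integral_sub ((mrec m1).const_mul 2) (integrable_const 1)]
    refine integral_mono (((mrec m1).const_mul 2).sub (integrable_const 1)) (mrec m2) fun x => ?_
    have e1 : {g : Fin d → ℝ | (Fin.cons x g : Fin (d + 1) → ℝ) ∈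
        {g : Fin (d + 1) → ℝ | ∑ k, σ k * g k ≤ a}}
        = {g | ∑ k, σ k.succ * g k ≤ a - σ 0 * x} := by
      ext g
      simp only [Set.mem_ofPred_eq, Fin.sum_univ_succ, Fin.cons_zero, Fin.cons_succ]
      constructor <;> intro h <;> linarith
    have hIic : ∀ (f : Fin (d + 1) → ℝ) (i : Fin d),
        ∑ k ∈ Finset.Iic i.succ, f k = f 0 + ∑ k ∈ Finset.Iic i, f k.succ := by
      intro f i
      simp_rw [← Finset.filter_ge_eq_Iic, Finset.sum_filter, Fin.sum_univ_succ]
      simp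
    have e2 : {g : Fin d → ℝ | (Fin.cons x g : Fin (d + 1) → ℝ) ∈
        {g : Fin (d + 1) → ℝ | 0 ≤ a ∧ ∀ i, ∑ k ∈ Finset.Iic i, σ k * g k ≤ a}}
        = {g | 0 ≤ a - σ 0 * x ∧ ∀ i, ∑ k ∈ Finset.Iic i, σ k.succ * g k ≤ a - σ 0 * x} := by
      ext g
      have h0 : Finset.Iic (0 : Fin (d + 1)) = {0} := by
        ext k
        simp
      simp only [Set.mem_ofPred_eq, Fin.forall_fin_succ, hIic, h0, Finset.sum_singleton,
        Fin.cons_zero, Fin.cons_succ, ha, true_and]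
      refine and_congr (by constructor <;> intro h <;> linarith) (forall_congr' fun i => ?_)
      constructor <;> intro h <;> linarith
    simp only [e1, e2]
    exact ih (fun k => σ k.succ) (a - σ 0 * x)

end GaussianWalk

/-! ### One-dimensional Gaussian estimates. -/

section OneDimensional

theorem sub_mul_gaussianPDFReal_le {v : NNReal} (hv : v ≠ 0) {a b : ℝ} (ha : 0 ≤ a) (hab : a ≤ b) :
    (b - a) * gaussianPDFReal 0 v b ≤ (gaussianReal 0 v).real (Set.Ioc a b) := by
  rw [measureReal_def, gaussianReal_apply_eq_integral _ hv, ENNReal.toReal_ofReal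
    (setIntegral_nonneg measurableSet_Ioc fun x _ => gaussianPDFReal_nonneg _ _ _)]
  calc (b - a) * gaussianPDFReal 0 v b = ∫ x in Set.Ioc a b, gaussianPDFReal 0 v b := by
        rw [setIntegral_const, smul_eq_mul, Real.volume_real_Ioc_of_le hab]
    _ ≤ ∫ x in Set.Ioc a b, gaussianPDFReal 0 v x := by
        refine setIntegral_mono_on (integrable_const _) (integrable_gaussianPDFReal _ _).integrableOn
          measurableSet_Ioc fun x hx => ?_
        simp only [gaussianPDFReal_def, sub_zero]
        have : x ^ 2 ≤ b ^ 2 := by nlinarith [hx.1, hx.2]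
        gcongr

theorem gaussianReal_real_Iic_zero (v : NNReal) : 1 ≤ 2 * (gaussianReal 0 v).real (Set.Iic 0) := by
  have h1 : (gaussianReal 0 v).real (Set.Iic 0) = (gaussianReal 0 v).real (Set.Ici 0) := by
    have := gaussianReal_map_neg (μ := 0) (v := v)
    rw [neg_zero] at this
    conv_lhs => rw [← this]
    rw [map_measureReal_apply (by fun_prop) measurableSet_Iic]
    congr 1
    ext z
    simp
  have h2 := measureReal_union_le (μ := gaussianReal 0 v) (Set.Iic 0) (Set.Ici 0)
  rw [Set.Iic_union_Ici, probReal_univ] at h2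
  linarith

/-- The value at `1` of the standard normal density. -/
noncomputable def normalDensityAtOne : ℝ := (√(2 * Real.pi))⁻¹ * Real.exp (-1 / 2)

theorem normalDensityAtOne_pos : 0 < normalDensityAtOne := by
  unfold normalDensityAtOne
  positivity

theorem normalDensityAtOne_le_one : normalDensityAtOne ≤ 1 := by
  unfold normalDensityAtOne
  refine mul_le_one₀ (inv_le_one_of_one_le₀ ?_) (Real.exp_pos _).le
    (Real.exp_le_one_iff.2 (by norm_num))
  rw [Real.one_le_sqrt]
  linarith [Real.pi_gt_three]

theorem correlationFactor_nonneg (u ρ : ℝ) : 0 ≤ correlationFactor u ρ := by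
  unfold correlationFactor
  split_ifs <;> positivity

theorem correlationFactor_le_one (u ρ : ℝ) : correlationFactor u ρ ≤ 1 := by
  unfold correlationFactor
  split_ifs
  · exact le_rfl
  · exact min_le_left _ _

/-- The correlation factor is `min 1 (1 / (u √v))` with `v = ρ / (1 - ρ)`. Hence `(0, f √v]` lies
below `1/u` and within one standard deviation of `0`, where the density is at least its value at
`√v`. -/
theorem normalDensityAtOne_mul_correlationFactor_le {u ρ : ℝ} (hu : 1 ≤ u) (h0 : 0 ≤ ρ)
    (h1 : ρ < 1) :
    normalDensityAtOne * correlationFactor u ρ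
      ≤ 2 * (gaussianReal 0 (ρ / (1 - ρ)).toNNReal).real (Set.Iic (1 / u)) - 1 := by
  have hu0 : 0 < u := by linarith
  rcases h0.eq_or_lt with h | h
  · subst h
    have : (gaussianReal 0 (0 / (1 - 0) : ℝ).toNNReal).real (Set.Iic (1 / u)) = 1 := by
      simp [measureReal_def, hu0.le]
    rw [this]
    calc _ ≤ (1 : ℝ) * 1 := mul_le_mul normalDensityAtOne_le_one (correlationFactor_le_one _ _)
            (correlationFactor_nonneg _ _) zero_le_one
      _ = _ := by norm_num
  · set v := (ρ / (1 - ρ)).toNNReal with hv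
    have hs : 0 < ρ / (1 - ρ) := div_pos h (by linarith)
    have hvs : (v : ℝ) = ρ / (1 - ρ) := Real.coe_toNNReal _ hs.le
    have hv0 : v ≠ 0 := by
      intro h'
      rw [h'] at hvs
      simp at hvs
      rw [← hvs] at hs
      exact lt_irrefl _ hs
    have hsq : 0 < √(v : ℝ) := Real.sqrt_pos.2 (hvs ▸ hs)
    set f := correlationFactor u ρ with hf
    have hf' : f = min 1 (√((1 - ρ) / (u ^ 2 * ρ))) := by
      rw [hf, correlationFactor, if_neg h.ne']
    have hf1 : f ≤ 1 := correlationFactor_le_one _ _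
    have hf0 : 0 ≤ f := correlationFactor_nonneg _ _
    have hfu : f * √(v : ℝ) ≤ 1 / u := by
      have : √((1 - ρ) / (u ^ 2 * ρ)) * √(v : ℝ) = 1 / u := by
        rw [← Real.sqrt_mul (div_nonneg (by linarith) (by positivity)), hvs]
        have e : (1 - ρ) / (u ^ 2 * ρ) * (ρ / (1 - ρ)) = (1 / u) ^ 2 := by
          have : 1 - ρ ≠ 0 := by linarith
          field_simp
        rw [e, Real.sqrt_sq (by positivity)]
      rw [← this]
      gcongr
      rw [hf']
      exact min_le_right _ _
    have hy0 : 0 ≤ f * √(v : ℝ) := by positivity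
    have hdens : normalDensityAtOne * f ≤ (gaussianReal 0 v).real (Set.Ioc 0 (f * √(v : ℝ))) := by
      refine le_trans ?_ (sub_mul_gaussianPDFReal_le hv0 le_rfl hy0)
      rw [gaussianPDFReal_def, normalDensityAtOne, Real.sqrt_mul (by positivity : 0 ≤ 2 * Real.pi)]
      have he : Real.exp (-1 / 2) ≤ Real.exp (-(f * √(v : ℝ) - 0) ^ 2 / (2 * v)) := by
        rw [Real.exp_le_exp, sub_zero, mul_pow, Real.sq_sqrt (NNReal.coe_nonneg v)]
        have hvp : (0 : ℝ) < v := hvs ▸ hs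
        rw [div_le_div_iff₀ (by norm_num) (by positivity)]
        nlinarith [pow_le_one₀ hf0 hf1 (n := 2)]
      calc (√(2 * Real.pi))⁻¹ * Real.exp (-1 / 2) * f
          = (f * √(v : ℝ) - 0) * ((√(2 * Real.pi) * √(v : ℝ))⁻¹ * Real.exp (-1 / 2)) := by
            field_simp
            ring
        _ ≤ _ := mul_le_mul_of_nonneg_left (mul_le_mul_of_nonneg_left he (by positivity))
            (by linarith)
    have hunion : (gaussianReal 0 v).real (Set.Iic 0)
        + (gaussianReal 0 v).real (Set.Ioc 0 (f * √(v : ℝ)))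
        ≤ (gaussianReal 0 v).real (Set.Iic (1 / u)) := by
      rw [← measureReal_union (Set.Iic_disjoint_Ioc le_rfl) measurableSet_Ioc,
        Set.Iic_union_Ioc_eq_Iic hy0]
      exact measureReal_mono (Set.Iic_subset_Iic.2 hfu)
    have := gaussianReal_real_Iic_zero v
    have hp : 0 ≤ normalDensityAtOne * f := mul_nonneg normalDensityAtOne_pos.le hf0
    linarith

/-- Length of the interval times the density at its right end; `(u + 1/u)² ≤ u² + 3` gives the
factor `exp (-3/2)`. -/
theorem gaussianReal_real_Ioc_add_inv_ge {u : ℝ} (hu : 1 ≤ u) :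
    (√(2 * Real.pi))⁻¹ * Real.exp (-3 / 2) * (Real.exp (-u ^ 2 / 2) / u)
      ≤ (gaussianReal 0 1).real (Set.Ioc u (u + 1 / u)) := by
  have hu0 : 0 < u := by linarith
  have hi : 0 < 1 / u := by positivity
  refine le_trans ?_ (sub_mul_gaussianPDFReal_le one_ne_zero hu0.le (by linarith))
  rw [gaussianPDFReal_def]
  simp only [NNReal.coe_one, mul_one, sub_zero, add_sub_cancel_left]
  have he : Real.exp (-3 / 2) * Real.exp (-u ^ 2 / 2) ≤ Real.exp (-(u + 1 / u) ^ 2 / 2) := by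
    rw [← Real.exp_add, Real.exp_le_exp]
    have h1 : u * (1 / u) = 1 := by field_simp
    have h2 : 1 / u ≤ 1 := by
      rw [div_le_one hu0]
      exact hu
    nlinarith
  calc _ = 1 / u * ((√(2 * Real.pi))⁻¹ * (Real.exp (-3 / 2) * Real.exp (-u ^ 2 / 2))) := by
        ring
    _ ≤ _ := by gcongr

end OneDimensional

/-! ### The comparison process: Brownian bridge plus independent noise. -/

section ComparisonProcess

theorem measurable_sum_mul {ι : Type*} [Fintype ι] (σ : ι → ℝ) :
    Measurable (fun g : ι → ℝ => ∑ k, σ k * g k) := by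
  fun_prop

theorem integral_sum_mul_piGaussian {ι : Type*} [Fintype ι] (σ : ι → ℝ) :
    ∫ g, (∑ k, σ k * g k) ∂(piGaussian ι) = 0 := by
  have : ∫ y, y ∂((piGaussian ι).map (fun g => ∑ k, σ k * g k)) = 0 := by
    rw [map_sum_mul_piGaussian, integral_id_gaussianReal]
  rwa [integral_map (measurable_sum_mul σ).aemeasurable (by fun_prop)] at this

theorem memLp_sum_mul_piGaussian {ι : Type*} [Fintype ι] (σ : ι → ℝ) :
    MemLp (fun g => ∑ k, σ k * g k) 2 (piGaussian ι) := by
  have h : MemLp id 2 ((piGaussian ι).map (fun g => ∑ k, σ k * g k)) := by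
    rw [map_sum_mul_piGaussian]
    exact IsGaussian.memLp_two_id
  exact h.comp_of_map (measurable_sum_mul σ).aemeasurable

theorem integral_sq_sum_mul_piGaussian {ι : Type*} [Fintype ι] (σ : ι → ℝ) :
    ∫ g, (∑ k, σ k * g k) ^ 2 ∂(piGaussian ι) = ∑ k, σ k ^ 2 := by
  have hv : Var[id; gaussianReal 0 (∑ k, σ k ^ 2).toNNReal] = ∑ k, σ k ^ 2 := by
    rw [variance_id_gaussianReal, Real.coe_toNNReal _ (Finset.sum_nonneg fun k _ => sq_nonneg _)]
  rw [variance_of_integral_eq_zero (by fun_prop) (by simp), ← map_sum_mul_piGaussian,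
    integral_map (measurable_sum_mul σ).aemeasurable (by fun_prop)] at hv
  exact hv

theorem integral_sum_mul_sum_piGaussian {ι : Type*} [Fintype ι] (σ τ : ι → ℝ) :
    ∫ g, (∑ k, σ k * g k) * (∑ k, τ k * g k) ∂(piGaussian ι) = ∑ k, σ k * τ k := by
  have e : ∀ g : ι → ℝ, (∑ k, σ k * g k) * (∑ k, τ k * g k)
      = 4⁻¹ * ((∑ k, (σ k + τ k) * g k) ^ 2 - (∑ k, (σ k - τ k) * g k) ^ 2) := by
    intro g
    simp only [add_mul, sub_mul, Finset.sum_add_distrib, Finset.sum_sub_distrib]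
    ring
  simp_rw [e]
  rw [integral_const_mul, integral_sub (memLp_sum_mul_piGaussian _).integrable_sq
    (memLp_sum_mul_piGaussian _).integrable_sq, integral_sq_sum_mul_piGaussian,
    integral_sq_sum_mul_piGaussian, ← Finset.sum_sub_distrib, Finset.mul_sum]
  exact Finset.sum_congr rfl fun k _ => by ring

theorem integral_prod_add_mul_add {α β : Type*} [MeasurableSpace α] [MeasurableSpace β]
    {μ : Measure α} {ν : Measure β} [IsProbabilityMeasure μ] [IsProbabilityMeasure ν]
    {f f' : α → ℝ} {g g' : β → ℝ} (hf : MemLp f 2 μ) (hf' : MemLp f' 2 μ) (hg : MemLp g 2 ν)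
    (hg' : MemLp g' 2 ν) (f0 : ∫ x, f x ∂μ = 0) (f0' : ∫ x, f' x ∂μ = 0) :
    ∫ z : α × β, (f z.1 + g z.2) * (f' z.1 + g' z.2) ∂(μ.prod ν)
      = ∫ x, f x * f' x ∂μ + ∫ y, g y * g' y ∂ν := by
  have i1 : Integrable (fun z : α × β => f z.1 * f' z.1) (μ.prod ν) :=
    (hf.integrable_mul hf').comp_fst ν
  have i2 : Integrable (fun z : α × β => f z.1 * g' z.2) (μ.prod ν) :=
    (hf.integrable (by norm_num)).mul_prod (hg'.integrable (by norm_num))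
  have i3 : Integrable (fun z : α × β => f' z.1 * g z.2) (μ.prod ν) :=
    (hf'.integrable (by norm_num)).mul_prod (hg.integrable (by norm_num))
  have i4 : Integrable (fun z : α × β => g z.2 * g' z.2) (μ.prod ν) :=
    (hg.integrable_mul hg').comp_snd μ
  have e : ∀ z : α × β, (f z.1 + g z.2) * (f' z.1 + g' z.2)
      = f z.1 * f' z.1 + f z.1 * g' z.2 + (f' z.1 * g z.2 + g z.2 * g' z.2) := fun z => by ring
  simp_rw [e]
  have i12 : Integrable (fun z : α × β => f z.1 * f' z.1 + f z.1 * g' z.2) (μ.prod ν) := i1.add i2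
  have i34 : Integrable (fun z : α × β => f' z.1 * g z.2 + g z.2 * g' z.2) (μ.prod ν) := i3.add i4
  rw [integral_add i12 i34, integral_add i1 i2, integral_add i3 i4,
    integral_prod_mul, integral_prod_mul, f0, f0',
    integral_fun_fst (fun x => f x * f' x), integral_fun_snd (fun y => g y * g' y)]
  simp

/-- Supplies step sizes of a Gaussian walk that samples Brownian motion at the times `s i`. -/
theorem exists_increments {d : ℕ} (s : Fin (d + 1) → ℝ) (hs : Monotone s) (h0 : 0 ≤ s 0) :
    ∃ σ : Fin (d + 1) → ℝ, ∀ i, ∑ k ∈ Finset.Iic i, σ k ^ 2 = s i := by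
  refine ⟨Fin.cons (√(s 0)) fun k : Fin d => √(s k.succ - s k.castSucc), fun i => ?_⟩
  induction i using Fin.induction with
  | zero =>
    have h : Finset.Iic (0 : Fin (d + 1)) = {0} := by
      ext k
      simp
    rw [h, Finset.sum_singleton, Fin.cons_zero, Real.sq_sqrt h0]
  | succ i ih =>
    have h : Finset.Iic i.succ = insert i.succ (Finset.Iic i.castSucc) := by
      ext k
      simp only [Finset.mem_Iic, Finset.mem_insert, Fin.le_iff_val_le_val, Fin.ext_iff,
        Fin.val_succ, Fin.val_castSucc]
      omega
    have h' : i.succ ∉ Finset.Iic i.castSucc := by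
      simp [Fin.le_iff_val_le_val]
    rw [h, Finset.sum_insert h', ih, Fin.cons_succ,
      Real.sq_sqrt (sub_nonneg.2 (hs (Fin.castSucc_lt_succ).le))]
    ring

/-- The probability that a Gaussian vector, whose covariances dominate those of the sum of an
independent sequence and a Brownian bridge at the times `ρ i`, stays below a barrier. -/
theorem le_real_forall_le_of_covariance_ge {d : ℕ} {ρ : Fin (d + 1) → ℝ} (hρ : Monotone ρ)
    (hρ0 : ∀ i, 0 ≤ ρ i) (hρ1 : ∀ i, ρ i < 1) {μ : Measure (Fin (d + 1) → ℝ)} [IsGaussian μ]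
    (hmean : ∀ i, ∫ x, x i ∂μ = 0) (hvar : ∀ i, ∫ x, x i * x i ∂μ = 1 - ρ i ^ 2)
    (hcov : ∀ i j, i ≤ j → ρ i * (1 - ρ j) ≤ ∫ x, x i * x j ∂μ) {u : ℝ} (hu : 1 ≤ u) :
    normalDensityAtOne * correlationFactor u (ρ (Fin.last d)) *
        ∏ i, stdNormalCDF (u * √(1 - ρ i) * (1 + -(3 / (u ^ 2 * (1 - ρ i)))))
      ≤ μ.real {x | ∀ i, x i ≤ u * (1 - ρ i) - 1 / u} := by
  have hu0 : 0 < u := by linarith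
  have hpos : ∀ i, 0 < 1 - ρ i := fun i => sub_pos.2 (hρ1 i)
  obtain ⟨σ, hσ⟩ := exists_increments (fun i => ρ i / (1 - ρ i))
    (fun i j hij => div_le_div₀ (hρ0 j) (hρ hij) (hpos j) (by linarith [hρ hij]))
    (div_nonneg (hρ0 0) (hpos 0).le)
  set γ := piGaussian (Fin (d + 1)) with hγ
  -- The rows of `a` give the independent noise; those of `b` give the bridge `(1 - t) W (t / (1 -
  -- t))` at `t = ρ i`.
  set a : Fin (d + 1) → Fin (d + 1) → ℝ := fun i k => if k = i then √(1 - ρ i) else 0 with ha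
  set b : Fin (d + 1) → Fin (d + 1) → ℝ := fun i k => if k ≤ i then (1 - ρ i) * σ k else 0 with hb
  have sum_a : ∀ i (x : Fin (d + 1) → ℝ), ∑ k, a i k * x k = √(1 - ρ i) * x i := by
    intro i x
    simp [ha]
  have sum_b : ∀ i (g : Fin (d + 1) → ℝ), ∑ k, b i k * g k
      = (1 - ρ i) * ∑ k ∈ Finset.Iic i, σ k * g k := by
    intro i g
    simp_rw [hb, ← Finset.filter_ge_eq_Iic, Finset.sum_filter, Finset.mul_sum]
    refine Finset.sum_congr rfl fun k _ => ?_
    split_ifs <;> ring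
  set T : (Fin (d + 1) → ℝ) × (Fin (d + 1) → ℝ) →L[ℝ] (Fin (d + 1) → ℝ) :=
    ContinuousLinearMap.pi fun i =>
      (∑ k, a i k • ContinuousLinearMap.proj (R := ℝ) (φ := fun _ : Fin (d + 1) => ℝ) k).comp
        (ContinuousLinearMap.fst ℝ _ _) +
      (∑ k, b i k • ContinuousLinearMap.proj (R := ℝ) (φ := fun _ : Fin (d + 1) => ℝ) k).comp
        (ContinuousLinearMap.snd ℝ _ _) with hT
  have T_apply : ∀ z i, T z i = ∑ k, a i k * z.1 k + ∑ k, b i k * z.2 k := by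
    intro z i
    simp [hT]
  set τ := (γ.prod γ).map T with hτ
  have τmean : ∀ i, ∫ x, x i ∂τ = 0 := by
    intro i
    rw [hτ, integral_map (by fun_prop) (Continuous.aestronglyMeasurable (by fun_prop))]
    simp_rw [T_apply]
    rw [integral_add (((memLp_sum_mul_piGaussian (a i)).integrable (by norm_num)).comp_fst γ)
      (((memLp_sum_mul_piGaussian (b i)).integrable (by norm_num)).comp_snd γ),
      integral_fun_fst (fun x : Fin (d + 1) → ℝ => ∑ k, a i k * x k),
      integral_fun_snd (fun x : Fin (d + 1) → ℝ => ∑ k, b i k * x k),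
      integral_sum_mul_piGaussian, integral_sum_mul_piGaussian]
    simp
  have τcov : ∀ i j, ∫ x, x i * x j ∂τ = ∑ k, a i k * a j k + ∑ k, b i k * b j k := by
    intro i j
    rw [hτ, integral_map (by fun_prop) (Continuous.aestronglyMeasurable (by fun_prop))]
    simp_rw [T_apply]
    rw [integral_prod_add_mul_add (memLp_sum_mul_piGaussian (a i)) (memLp_sum_mul_piGaussian (a j))
      (memLp_sum_mul_piGaussian (b i)) (memLp_sum_mul_piGaussian (b j))
      (integral_sum_mul_piGaussian _) (integral_sum_mul_piGaussian _),
      integral_sum_mul_sum_piGaussian, integral_sum_mul_sum_piGaussian]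
  have sum_bb : ∀ i j, i ≤ j → ∑ k, b i k * b j k = ρ i * (1 - ρ j) := by
    intro i j hij
    have : ∀ k, b i k * b j k = if k ≤ i then (1 - ρ i) * (1 - ρ j) * σ k ^ 2 else 0 := by
      intro k
      simp only [hb]
      by_cases h : k ≤ i
      · rw [if_pos h, if_pos h, if_pos (h.trans hij)]
        ring
      · rw [if_neg h, if_neg h, zero_mul]
    simp_rw [this]
    rw [← Finset.sum_filter, Finset.filter_ge_eq_Iic, ← Finset.mul_sum, hσ]
    have := (hpos i).ne'
    field_simp
  have sum_aa : ∀ i, ∑ k, a i k * a i k = 1 - ρ i := by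
    intro i
    simp [ha, Real.mul_self_sqrt (hpos i).le]
  have sum_aa' : ∀ i j, i ≠ j → ∑ k, a i k * a j k = 0 := by
    intro i j hij
    simp [ha, hij.symm]
  have hdiag : ∀ i, ∫ x, x i * x i ∂τ = ∫ x, x i * x i ∂μ := by
    intro i
    rw [τcov, hvar, sum_aa, sum_bb i i le_rfl]
    ring
  have hoff : ∀ i j, ∫ x, x i * x j ∂τ ≤ ∫ x, x i * x j ∂μ := by
    have hlt : ∀ i j, i < j → ∫ x, x i * x j ∂τ ≤ ∫ x, x i * x j ∂μ := by
      intro i j hij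
      rw [τcov, sum_aa' i j hij.ne, sum_bb i j hij.le, zero_add]
      exact hcov i j hij.le
    intro i j
    rcases lt_trichotomy i j with h | rfl | h
    · exact hlt i j h
    · exact (hdiag i).le
    · have := hlt j i h
      simpa only [mul_comm] using this
  have slepian := real_forall_le_sub_le_of_covariance_le τmean hmean hdiag hoff
    (fun i => u * (1 - ρ i) - 1 / u) (δ := 1 / u) (by positivity)
  refine le_trans ?_ slepian
  have measLe : ∀ c : Fin (d + 1) → ℝ, MeasurableSet {x : Fin (d + 1) → ℝ | ∀ i, x i ≤ c i} :=
    fun c => measurableSet_setOfPred.2 (by fun_prop)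
  rw [hτ, map_measureReal_apply (by fun_prop) (measLe _)]
  set c : Fin (d + 1) → ℝ := fun i => u * √(1 - ρ i) * (1 + -(3 / (u ^ 2 * (1 - ρ i)))) with hc
  -- The noise is at most `u (1 - ρ i) - 3/u` and the bridge at most `1/u`. The `3` pays for the
  -- bridge, the Slepian margin `δ = 1/u` and the `1/u` already in the barrier.
  have hsub : ({x | ∀ i, x i ≤ c i} ×ˢ {g | 0 ≤ 1 / u ∧ ∀ i, ∑ k ∈ Finset.Iic i, σ k * g k ≤ 1 / u} :
      Set ((Fin (d + 1) → ℝ) × (Fin (d + 1) → ℝ)))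
      ⊆ T ⁻¹' {x | ∀ i, x i ≤ u * (1 - ρ i) - 1 / u - 1 / u} := by
    rintro ⟨x, g⟩ ⟨hx, hg⟩ i
    rw [T_apply, sum_a, sum_b]
    have h1 := mul_le_mul_of_nonneg_left (hx i) (Real.sqrt_nonneg (1 - ρ i))
    have h2 := mul_le_mul_of_nonneg_left (hg.2 i) (hpos i).le
    have e : √(1 - ρ i) * c i = u * (1 - ρ i) - 3 * (1 / u) := by
      have hs := Real.mul_self_sqrt (hpos i).le
      have hne := (hpos i).ne'
      calc √(1 - ρ i) * c i
          = u * (√(1 - ρ i) * √(1 - ρ i)) * (1 + -(3 / (u ^ 2 * (1 - ρ i)))) := by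
            rw [hc]
            ring
        _ = u * (1 - ρ i) - 3 * (1 / u) := by
            rw [hs]
            field_simp
            ring
    have h3 : 0 < 1 / u := by positivity
    have h4 := hρ0 i
    simp only at h1 h2 ⊢
    nlinarith
  refine le_trans ?_ (measureReal_mono hsub)
  rw [measureReal_prod_prod]
  have hprod : γ.real {x | ∀ i, x i ≤ c i} = ∏ i, stdNormalCDF (c i) := by
    have : {x : Fin (d + 1) → ℝ | ∀ i, x i ≤ c i} = Set.univ.pi fun i => Set.Iic (c i) := by
      ext x
      simp [Pi.le_def]
    rw [this, measureReal_def, hγ, Measure.pi_pi, ENNReal.toReal_prod]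
    refine Finset.prod_congr rfl fun i _ => ?_
    rw [stdNormalCDF, cdf_eq_real, measureReal_def]
  rw [hprod, mul_comm]
  refine mul_le_mul_of_nonneg_left ?_ (Finset.prod_nonneg fun i _ => cdf_nonneg _ _)
  refine le_trans ?_ (two_mul_piGaussian_real_sub_one_le _ σ (1 / u))
  have hsum : ∑ k, σ k ^ 2 = ρ (Fin.last d) / (1 - ρ (Fin.last d)) := by
    rw [← hσ (Fin.last d)]
    congr 1
    ext k
    simp [Fin.le_last]
  have hwalk : (piGaussian (Fin (d + 1))).real {g | ∑ k, σ k * g k ≤ 1 / u}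
      = (gaussianReal 0 (ρ (Fin.last d) / (1 - ρ (Fin.last d))).toNNReal).real
          (Set.Iic (1 / u)) := by
    rw [← hsum, ← map_sum_mul_piGaussian, map_measureReal_apply (by fun_prop) measurableSet_Iic]
    rfl
  rw [hwalk]
  exact normalDensityAtOne_mul_correlationFactor_le hu (hρ0 _) (hρ1 _)

end ComparisonProcess

/-! ### First passage decomposition and the main theorem. -/

section MainTheorem

theorem stdNormalCDF_nonneg (x : ℝ) : 0 ≤ stdNormalCDF x := cdf_nonneg _ _

theorem stdNormalCDF_le_one (x : ℝ) : stdNormalCDF x ≤ 1 := cdf_le_one _ _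

/-- Only the lags `1, …, m` occur at time `m`; the extra factors are at most `1`, which makes the
bound uniform in `m`. -/
theorem prod_Icc_le_prod_fin {f : ℕ → ℝ} (h0 : ∀ j, 0 ≤ f j) (h1 : ∀ j, f j ≤ 1) {n m : ℕ}
    (hm : m < n) : ∏ j ∈ Finset.Icc 1 (n - 1), f j ≤ ∏ i : Fin m, f (m - i) := by
  have e : ∏ i : Fin m, f (m - i) = ∏ j ∈ Finset.Icc 1 m, f j := by
    rw [Fin.prod_univ_eq_prod_range (fun i => f (m - i)) m]
    refine Finset.prod_nbij' (fun i => m - i) (fun j => m - j) ?_ ?_ ?_ ?_ ?_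
    · intro i hi
      simp at hi ⊢
      omega
    · intro i hi
      simp at hi ⊢
      omega
    · intro i hi
      simp at hi ⊢
      omega
    · intro i hi
      simp at hi ⊢
      omega
    · intro i _
      rfl
  have hsub : Finset.Icc 1 m ⊆ Finset.Icc 1 (n - 1) := Finset.Icc_subset_Icc_right (by omega)
  rw [e, ← Finset.prod_sdiff hsub]
  exact mul_le_of_le_one_left (Finset.prod_nonneg fun j _ => h0 j)
    (Finset.prod_le_one (fun j _ => h0 j) fun j _ => h1 j)

/-- The event that the process lies just above the level `u` at time `m` and does not exceed `u`
before. -/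
def firstPassage (n : ℕ) (u : ℝ) (m : Fin n) : Set (Fin n → ℝ) :=
  {z | z m ∈ Set.Ioc u (u + 1 / u) ∧ ∀ j < m, z j ≤ u}

theorem measurableSet_firstPassage (n : ℕ) (u : ℝ) (m : Fin n) :
    MeasurableSet (firstPassage n u m) := by
  have h1 : MeasurableSet {z : Fin n → ℝ | z m ∈ Set.Ioc u (u + 1 / u)} :=
    measurableSet_Ioc.preimage (measurable_pi_apply m)
  have h2 : MeasurableSet {z : Fin n → ℝ | ∀ j < m, z j ≤ u} :=
    measurableSet_setOfPred.2 (by fun_prop)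
  exact h1.inter h2

theorem disjoint_firstPassage {n : ℕ} {u : ℝ} {m m' : Fin n} (h : m ≠ m') :
    Disjoint (firstPassage n u m) (firstPassage n u m') := by
  have aux : ∀ k l : Fin n, k < l → Disjoint (firstPassage n u k) (firstPassage n u l) := by
    intro k l hkl
    rw [Set.disjoint_left]
    intro z hk hl
    exact absurd (hl.2 k hkl) (not_le.2 hk.1.1)
  rcases lt_or_gt_of_ne h with h | h
  · exact aux _ _ h
  · exact (aux _ _ h).symm

theorem map_eval_eq_gaussianReal {n : ℕ} {μ : Measure (Fin n → ℝ)} [IsGaussian μ]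
    (m : Fin n) (hmean : ∫ z, z m ∂μ = 0) (hvar : ∫ z, z m * z m ∂μ = 1) :
    μ.map (fun z => z m) = gaussianReal 0 1 := by
  have h := IsGaussian.map_eq_gaussianReal (μ := μ)
    (ContinuousLinearMap.proj (R := ℝ) (φ := fun _ : Fin n => ℝ) m)
  have hv : Var[fun z : Fin n → ℝ => z m; μ] = 1 := by
    rw [variance_of_integral_eq_zero (measurable_pi_apply m).aemeasurable hmean, ← hvar]
    simp_rw [sq]
  change μ.map (fun z => z m) = gaussianReal (∫ z, z m ∂μ)
    (Var[fun z : Fin n → ℝ => z m; μ]).toNNReal at h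
  rw [h, hmean, hv, Real.toNNReal_one]

theorem le_real_firstPassage {n : ℕ} {μ : Measure (Fin n → ℝ)} [IsGaussian μ] {r : ℕ → ℝ}
    (hmean : ∀ i, ∫ z, z i ∂μ = 0) (hvar : ∀ i, ∫ z, z i * z i ∂μ = 1)
    (hcorr : ∀ i j : Fin n, ∫ z, z i * z j ∂μ = r ((i : ℤ) - (j : ℤ)).natAbs)
    (hanti : AntitoneOn r (Set.Iio n)) (hr0 : ∀ j < n, 0 ≤ r j) (hr1 : 1 < n → r 1 < 1)
    {u : ℝ} (hu : 1 ≤ u) (m : Fin n) :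
    (√(2 * Real.pi))⁻¹ * Real.exp (-3 / 2) * (Real.exp (-u ^ 2 / 2) / u) *
      (normalDensityAtOne * correlationFactor u (r 1) * ∏ j ∈ Finset.Icc 1 (n - 1),
        stdNormalCDF (u * √(1 - r j) * (1 + -(3 / (u ^ 2 * (1 - r j))))))
      ≤ μ.real (firstPassage n u m) := by
  have hu0 : 0 < u := by linarith
  obtain ⟨m, hm⟩ := m
  have hIoc : μ.real {z | z ⟨m, hm⟩ ∈ Set.Ioc u (u + 1 / u)}
      = (gaussianReal 0 1).real (Set.Ioc u (u + 1 / u)) := by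
    rw [← map_eval_eq_gaussianReal ⟨m, hm⟩ (hmean _) (hvar _),
      map_measureReal_apply (by fun_prop) measurableSet_Ioc]
    rfl
  have hΦ := prod_Icc_le_prod_fin (f := fun j =>
    stdNormalCDF (u * √(1 - r j) * (1 + -(3 / (u ^ 2 * (1 - r j))))))
    (fun _ => stdNormalCDF_nonneg _) (fun _ => stdNormalCDF_le_one _) hm
  have hcf0 := correlationFactor_nonneg u (r 1)
  have hκ0 := normalDensityAtOne_pos
  rcases m with _ | d
  · have hset : firstPassage n u ⟨0, hm⟩ = {z | z ⟨0, hm⟩ ∈ Set.Ioc u (u + 1 / u)} := by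
      ext z
      simp [firstPassage, Fin.lt_def]
    rw [hset, hIoc]
    refine le_trans (mul_le_of_le_one_right (by positivity) ?_)
      (gaussianReal_real_Ioc_add_inv_ge hu)
    refine mul_le_one₀ (mul_le_one₀ normalDensityAtOne_le_one hcf0 (correlationFactor_le_one _ _))
      (Finset.prod_nonneg fun _ _ => stdNormalCDF_nonneg _)
      (Finset.prod_le_one (fun _ _ => stdNormalCDF_nonneg _) fun _ _ => stdNormalCDF_le_one _)
  · set M : Fin n := ⟨d + 1, hm⟩ with hM
    set e : Fin (d + 1) → Fin n := Fin.castLE hm.le with he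
    -- The correlation with the passage time `d + 1`. It increases with `i`, so it can serve as
    -- bridge time, and its last value is `r 1`.
    set ρ : Fin (d + 1) → ℝ := fun i => r (d + 1 - i) with hρ
    have hn1 : 1 < n := by omega
    have hr : ∀ {a b : ℕ}, a ≤ b → b < n → r b ≤ r a := fun hab hb =>
      hanti (lt_of_le_of_lt hab hb) hb hab
    have ρmono : Monotone ρ := fun i j hij => hr (by
      have : (i : ℕ) ≤ j := hij
      omega) (by omega)
    have ρ0 : ∀ i, 0 ≤ ρ i := fun i => hr0 _ (by omega)
    have ρ1 : ∀ i, ρ i < 1 := fun i => (hr (a := 1) (by omega) (by omega)).trans_lt (hr1 hn1)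
    have corr_e : ∀ i : Fin (d + 1), ∫ z, z (e i) * z M ∂μ = ρ i := by
      intro i
      rw [hcorr]
      congr 1
      simp only [he, hM, Fin.val_castLE]
      omega
    have corr_ee : ∀ i j : Fin (d + 1), i ≤ j → ∫ z, z (e i) * z (e j) ∂μ = r (j - i) := by
      intro i j hij
      have : (i : ℕ) ≤ j := hij
      rw [hcorr]
      congr 1
      simp only [he, Fin.val_castLE]
      omega
    set T : (Fin n → ℝ) →L[ℝ] (Fin (d + 1) → ℝ) := ContinuousLinearMap.pi fun i =>
      ContinuousLinearMap.proj (R := ℝ) (φ := fun _ : Fin n => ℝ) (e i) -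
        ρ i • ContinuousLinearMap.proj (R := ℝ) (φ := fun _ : Fin n => ℝ) M with hT
    have T_apply : ∀ z i, T z i = z (e i) - ρ i * z M := by
      intro z i
      simp [hT]
    have h3 : MemLp id 3 μ := IsGaussian.memLp_id μ 3 (by norm_num)
    have i1 : ∀ i, Integrable (fun z : Fin n → ℝ => z i) μ := h3.integrable_coord
    have i2 : ∀ i j, Integrable (fun z : Fin n → ℝ => z i * z j) μ := h3.integrable_coord_mul
    have Tmean : ∀ i, ∫ z, T z i ∂μ = 0 := by
      intro i
      simp_rw [T_apply]
      rw [integral_sub (i1 _) ((i1 _).const_mul _), integral_const_mul, hmean, hmean]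
      simp
    have Tcov : ∀ i j, ∫ z, T z i * T z j ∂μ = ∫ z, z (e i) * z (e j) ∂μ - ρ i * ρ j := by
      intro i j
      have hexp : ∀ z, T z i * T z j = z (e i) * z (e j) - ρ j * (z (e i) * z M)
          - (ρ i * (z (e j) * z M) - ρ i * ρ j * (z M * z M)) := by
        intro z
        rw [T_apply, T_apply]
        ring
      simp_rw [hexp]
      have j1 : Integrable (fun z : Fin n → ℝ => z (e i) * z (e j) - ρ j * (z (e i) * z M)) μ :=
        (i2 _ _).sub ((i2 _ _).const_mul _)
      have j2 : Integrable (fun z : Fin n → ℝ =>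
          ρ i * (z (e j) * z M) - ρ i * ρ j * (z M * z M)) μ :=
        ((i2 _ _).const_mul _).sub ((i2 _ _).const_mul _)
      rw [integral_sub j1 j2, integral_sub (i2 _ _) ((i2 _ _).const_mul _),
        integral_sub ((i2 _ _).const_mul _) ((i2 _ _).const_mul _), integral_const_mul,
        integral_const_mul, integral_const_mul, corr_e, corr_e, hvar]
      ring
    have Tcross : ∀ i, ∫ z, z M * T z i ∂μ = 0 := by
      intro i
      have hexp : ∀ z : Fin n → ℝ, z M * T z i = z (e i) * z M - ρ i * (z M * z M) := by
        intro z
        rw [T_apply]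
        ring
      rw [integral_congr_ae (ae_of_all μ hexp), integral_sub (i2 _ _) ((i2 _ _).const_mul _), integral_const_mul, corr_e, hvar]
      ring
    -- Jointly Gaussian and uncorrelated, hence independent; `z M` is viewed as a vector indexed by
    -- `Unit`.
    have hind : IndepFun (fun z : Fin n → ℝ => z M) (fun z => T z) μ := by
      have hlaw : HasGaussianLaw (fun z : Fin n → ℝ =>
          ((fun _ : Unit => z M), (fun i => T z i))) μ := by
        have := (IsGaussian.hasGaussianLaw_id (μ := μ)).map
          ((ContinuousLinearMap.pi fun _ : Unit =>
            ContinuousLinearMap.proj (R := ℝ) (φ := fun _ : Fin n => ℝ) M).prod T)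
        exact this
      have := hlaw.indepFun_of_covariance_eval (X := fun _ z => z M) (Y := fun i z => T z i)
        fun _ i => by
          have m1 : MemLp (fun z : Fin n → ℝ => z M) 2 μ :=
            (ContinuousLinearMap.proj (R := ℝ) (φ := fun _ : Fin n => ℝ) M).comp_memLp'
              (IsGaussian.memLp_two_id (μ := μ))
          have m2 : MemLp (fun z : Fin n → ℝ => T z i) 2 μ :=
            ((ContinuousLinearMap.proj (R := ℝ) (φ := fun _ : Fin (d + 1) => ℝ) i).comp
              T).comp_memLp' (IsGaussian.memLp_two_id (μ := μ))
          rw [covariance_eq_sub m1 m2, hmean, zero_mul, sub_zero]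
          exact Tcross i
      exact this.comp (φ := fun f : Unit → ℝ => f ()) (ψ := id) (measurable_pi_apply _)
        measurable_id
    set B : Set (Fin (d + 1) → ℝ) := {x | ∀ i, x i ≤ u * (1 - ρ i) - 1 / u} with hB
    have mB : MeasurableSet B := measurableSet_setOfPred.2 (by fun_prop)
    -- Here `z j` is the residual plus `ρ j * z M`; the overshoot adds at most `ρ j / u ≤ 1/u`,
    -- which the barrier in `B` absorbs.
    have hsub : (fun z : Fin n → ℝ => z M) ⁻¹' Set.Ioc u (u + 1 / u) ∩ (fun z => T z) ⁻¹' B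
        ⊆ firstPassage n u M := by
      rintro z ⟨hz, hTz⟩
      refine ⟨hz, fun j hj => ?_⟩
      have hj' : (j : ℕ) < d + 1 := hj
      have hTj : T z ⟨j, hj'⟩ ≤ u * (1 - ρ ⟨j, hj'⟩) - 1 / u := hTz ⟨j, hj'⟩
      rw [T_apply] at hTj
      have hej : e ⟨j, hj'⟩ = j := by
        ext
        simp [he]
      rw [hej] at hTj
      have h1 := mul_le_mul_of_nonneg_left hz.2 (ρ0 ⟨j, hj'⟩)
      have h2 : ρ ⟨j, hj'⟩ * (1 / u) ≤ 1 / u :=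
        mul_le_of_le_one_left (by positivity) (ρ1 _).le
      simp only at h1
      nlinarith
    have hprob : μ.real ((fun z : Fin n → ℝ => z M) ⁻¹' Set.Ioc u (u + 1 / u) ∩
        (fun z => T z) ⁻¹' B)
        = (gaussianReal 0 1).real (Set.Ioc u (u + 1 / u)) * (μ.map T).real B := by
      rw [← hIoc, map_measureReal_apply (by fun_prop) mB, measureReal_def,
        hind.measure_inter_preimage_eq_mul _ _ measurableSet_Ioc mB, ENNReal.toReal_mul]
      rfl
    refine le_trans ?_ (measureReal_mono hsub)
    rw [hprob]
    have integral_T : ∀ H : (Fin (d + 1) → ℝ) → ℝ, Continuous H →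
        ∫ x, H x ∂(μ.map T) = ∫ z, H (T z) ∂μ := fun H hH =>
      integral_map (by fun_prop) hH.aestronglyMeasurable
    have key := le_real_forall_le_of_covariance_ge (μ := μ.map T) ρmono ρ0 ρ1
      (fun i => by rw [integral_T _ (by fun_prop), Tmean])
      (fun i => by
        rw [integral_T (fun x => x i * x i) (by fun_prop), Tcov, hvar, sq])
      (fun i j hij => by
        have h : (i : ℕ) ≤ j := hij
        rw [integral_T (fun x => x i * x j) (by fun_prop), Tcov, corr_ee i j hij]
        -- Monotonicity of `r` enters through `j - i ≤ d + 1 - i`, giving the bridge covariance as a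
        -- lower bound.
        have : ρ i ≤ r (j - i) := hr (by omega) (by omega)
        nlinarith) hu
    have hlast : ρ (Fin.last d) = r 1 := by
      simp [hρ]
    rw [hlast] at key
    refine mul_le_mul (gaussianReal_real_Ioc_add_inv_ge hu) (le_trans ?_ key) ?_ measureReal_nonneg
    · exact mul_le_mul_of_nonneg_left hΦ (by positivity)
    · exact mul_nonneg (by positivity) (Finset.prod_nonneg fun _ _ => stdNormalCDF_nonneg _)

theorem theorem1 :
    ∃ c : ℝ, 0 < c ∧ ∃ C : ℝ, 0 < C ∧
      ∀ (Ω : Type*) [MeasurableSpace Ω] (P : Measure Ω) [IsProbabilityMeasure P]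
        (n : ℕ) (Z : Fin n → Ω → ℝ) (r : ℕ → ℝ) (u : ℝ),
        1 ≤ n →
        IsStationaryGaussianSequence P Z r →
        AntitoneOn r (Set.Iio n) →
        (∀ j < n, 0 ≤ r j) →
        1 ≤ u →
        r 1 * (1 + 2 * (u ^ 2)⁻¹) ≤ 1 →
        ∃ E : ℕ → ℝ,
          (∀ j ∈ Finset.Icc 1 (n - 1), |E j| ≤ C * (1 / (u ^ 2 * (1 - r j)))) ∧
          c * (n * (Real.exp (-u ^ 2 / 2) / u) * correlationFactor u (r 1) *
              ∏ j ∈ Finset.Icc 1 (n - 1), stdNormalCDF (u * √(1 - r j) * (1 + E j)))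
            ≤ P.real {ω | u < ⨆ i, Z i ω} := by
  refine ⟨(√(2 * Real.pi))⁻¹ * Real.exp (-3 / 2) * normalDensityAtOne,
    mul_pos (by positivity) normalDensityAtOne_pos, 3, by norm_num, ?_⟩
  intro Ω _ P _ n Z r u hn hZ hanti hr0 hu hr1
  have hu0 : 0 < u := by linarith
  have hr1' : r 1 < 1 := by
    by_contra! h
    have : 0 < 2 * (u ^ 2)⁻¹ := by positivity
    nlinarith
  refine ⟨fun j => -(3 / (u ^ 2 * (1 - r j))), fun j hj => ?_, ?_⟩
  · have hj' := Finset.mem_Icc.1 hj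
    have hrj : r j ≤ r 1 := hanti (show 1 < n by omega) (show j < n by omega) hj'.1
    have : 0 < 1 - r j := by linarith
    rw [abs_neg, abs_of_nonneg (by positivity)]
    exact le_of_eq (by ring)
  set μ := P.map (fun ω i => Z i ω) with hμ
  have hG : IsGaussian μ := hZ.jointly_gaussian.isGaussian_map
  have hae : AEMeasurable (fun ω i => Z i ω) P := hZ.jointly_gaussian.aemeasurable
  have integral_Z : ∀ H : (Fin n → ℝ) → ℝ, Continuous H →
      ∫ z, H z ∂μ = ∫ ω, H (fun i => Z i ω) ∂P := fun H hH =>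
    integral_map hae hH.aestronglyMeasurable
  have key := le_real_firstPassage (μ := μ) (r := r)
    (fun i => by rw [integral_Z _ (by fun_prop), hZ.mean_zero])
    (fun i => by
      rw [integral_Z (fun z => z i * z i) (by fun_prop), ← hZ.variance_one i]
      simp_rw [sq])
    (fun i j => by
      rw [integral_Z (fun z => z i * z j) (by fun_prop), hZ.correlation])
    hanti hr0 (fun _ => hr1') hu
  have hunion : μ.real (⋃ m ∈ (Finset.univ : Finset (Fin n)), firstPassage n u m)
      = ∑ m, μ.real (firstPassage n u m) :=
    measureReal_biUnion_finset (fun k _ l _ hkl => disjoint_firstPassage hkl)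
      fun m _ => measurableSet_firstPassage n u m
  have hpre : μ.real (⋃ m ∈ (Finset.univ : Finset (Fin n)), firstPassage n u m)
      ≤ P.real {ω | u < ⨆ i, Z i ω} := by
    rw [measureReal_def, hμ, Measure.map_apply_of_aemeasurable hae
      (Finset.measurableSet_biUnion _ fun m _ => measurableSet_firstPassage n u m)]
    refine measureReal_mono (μ := P) fun ω hω => ?_
    simp only [Set.mem_preimage, Set.mem_iUnion] at hω
    obtain ⟨m, _, hm⟩ := hω
    exact lt_of_lt_of_le hm.1.1 (le_ciSup (f := fun i => Z i ω) (Set.finite_range _).bddAbove m)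
  refine le_trans ?_ (hunion ▸ hpre)
  refine le_trans (le_of_eq ?_) (Finset.card_nsmul_le_sum _ _ _ fun m _ => key m)
  rw [Finset.card_univ, Fintype.card_fin, nsmul_eq_mul]
  ring

end MainTheorem
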